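/- For $\ell\ge 0$ let $T_\ell$ be the complete tree of degree $3$ and depth $\ell$: the root has $3$ children, every other vertex at distance less than $\ell$ from the root has $2$ children, and the vertices at distance $\ell$ from the root are leaves ($T_0$ is a single vertex). For $\lambda>0$ let $p_\ell$ be the probability that the root of $T_\ell$ is occupied in the hard-core Gibbs distribution on $T_\ell$, in which each independent set $S$ has probability proportional to $\lambda^{|S|}$, and let $$p^+=\lim_{\ell\to\infty}p_{2\ell},\qquad p^-=\lim_{\ell\to\infty}p_{2\ell+1}.$$ With the convention $0\ln 0=0$ put $$H(x)=-x\ln x-(1-x)\ln(1-x),\qquad H_1(x,y)=-x(\ln x-\ln y)+(x-y)(\ln(y-x)-\ln y),$$ and, with $\Delta=3$, \begin{align*} \Phi_2(\alpha,\beta,\gamma,\delta,\varepsilon)={}&2(\alpha+\beta)\ln\lambda+H(\alpha)+H_1(\gamma,\alpha)+H_1(\alpha-\gamma,1-\alpha)+H(\beta)+H_1(\delta,\beta)+H_1(\beta-\delta,1-\beta)\\ &+\Delta\Big(H_1(\gamma,1-2\beta+\delta)-H(\gamma)+H_1(\varepsilon,1-2\beta+\delta-\gamma)+H_1(\alpha-\gamma-\varepsilon,\beta-\delta)\\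 &\qquad-H_1(\alpha-\gamma,1-\gamma)+H_1(\alpha-\gamma,1-\beta-\gamma-\varepsilon)-H_1(\alpha-\gamma,1-\alpha)\Big). \end{align*} Let $\lambda>\lambda_c(\mathbb T_3)=(\Delta-1)^{\Delta-1}/(\Delta-2)^{\Delta}\big|_{\Delta=3}=4$ and assume that $1/2\le p^+<1$. Then there is a constant $\chi>0$ such that for all real $\alpha,\beta$ with $|p^+-\alpha|<\chi$ and $|p^--\beta|<\chi$ the function $(\gamma,\delta,\varepsilon)\mapsto\Phi_2(\alpha,\beta,\gamma,\delta,\varepsilon)$ achieves its unique maximum over the region $$\gamma,\delta,\varepsilon\ge 0,\quad \alpha-\gamma-\varepsilon\ge 0,\quad \beta-\delta\ge 0,\quad 1-2\beta+\delta-\gamma-\varepsilon\ge 0,\quad 1-\alpha-\beta-\varepsilon\ge 0,\quad \beta-\delta+\varepsilon+\gamma-\alpha\ge 0$$ at the point $(\gamma,\delta,\varepsilon)=(\alpha^2,\beta^2,\alpha(1-\alpha-\beta))$; that is, this point lies in the region, and every other point of the region has a strictly smaller value. -/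

import Mathlib

open Filter Topology

/-- A finite graph with a distinguished vertex. -/
structure RootedGraph where
  /-- the vertices -/
  V : Type
  /-- there are finitely many vertices -/
  fintypeV : Fintype V
  /-- the graph -/
  graph : SimpleGraph V
  /-- the distinguished vertex -/
  root : V

attribute [instance] RootedGraph.fintypeV

namespace RootedGraph

/-- The graph with a single vertex. -/
def point : RootedGraph where
  V := Unit
  fintypeV := inferInstance
  graph := ⊥
  root := ()

/-- Take `d` disjoint copies of `T` and a new vertex `none`, which is the root of the result and is
joined to the root of each copy. -/
def graft (d : ℕ) (T : RootedGraph) : RootedGraph where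
  V := Option (Fin d × T.V)
  fintypeV := inferInstance
  graph :=
    { Adj := fun x y =>
        match x, y with
        | none, none => False
        | none, some (_, w) => w = T.root
        | some (_, v), none => v = T.root
        | some (i, v), some (j, w) => i = j ∧ T.graph.Adj v w
      symm := by
        constructor
        rintro (_ | ⟨i, v⟩) (_ | ⟨j, w⟩) h
        · exact h
        · exact h
        · exact h
        · exact ⟨h.1.symm, h.2.symm⟩
      loopless := by
        constructor
        rintro (_ | ⟨i, v⟩) h
        · exact h
        · exact T.graph.loopless.irrefl v h.2 }
  root := none

/-- The rooted tree of depth `ℓ` in which every vertex at distance less than `ℓ` from the root has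
exactly `b` children. -/
def aryTree (b : ℕ) : ℕ → RootedGraph
  | 0 => point
  | ℓ + 1 => graft b (aryTree b ℓ)

/-- The complete tree `T_ℓ` of degree `Δ` and depth `ℓ`: the ball of radius `ℓ` around the root in
the infinite `Δ`-regular tree. The root has `Δ` children, every other vertex at distance less than
`ℓ` from the root has `Δ - 1` children, and the vertices at distance `ℓ` are leaves. -/
def regularTree (Δ : ℕ) : ℕ → RootedGraph
  | 0 => point
  | ℓ + 1 => graft Δ (aryTree (Δ - 1) ℓ)

open scoped Classical in
/-- The partition function of the hard-core model at activity `lam`: the sum of `lam ^ |S|` over all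
independent sets `S`. -/
noncomputable def partitionFunction (T : RootedGraph) (lam : ℝ) : ℝ :=
  ∑ S ∈ Finset.univ.filter (fun S : Finset T.V => T.graph.IsIndepSet (S : Set T.V)), lam ^ S.card

open scoped Classical in
/-- The probability that the root is occupied in the Gibbs distribution of the hard-core model,
which gives probability `lam ^ |S| / Z` to each independent set `S`. -/
noncomputable def rootMarginal (T : RootedGraph) (lam : ℝ) : ℝ :=
  (∑ S ∈ Finset.univ.filter (fun S : Finset T.V =>
      T.graph.IsIndepSet (S : Set T.V) ∧ T.root ∈ S), lam ^ S.card) /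
    T.partitionFunction lam

end RootedGraph

/-- `p_ℓ`: the marginal probability that the root of the complete tree of degree `Δ` and depth `ℓ`
is occupied, at activity `lam`. -/
noncomputable def treeMarginal (Δ : ℕ) (lam : ℝ) (ℓ : ℕ) : ℝ :=
  (RootedGraph.regularTree Δ ℓ).rootMarginal lam

/-- `p` is the even limit `p⁺ = lim p_{2ℓ}`. -/
def IsPPlus (Δ : ℕ) (lam p : ℝ) : Prop :=
  Tendsto (fun ℓ : ℕ => treeMarginal Δ lam (2 * ℓ)) atTop (𝓝 p)

/-- `p` is the odd limit `p⁻ = lim p_{2ℓ+1}`. -/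
def IsPMinus (Δ : ℕ) (lam p : ℝ) : Prop :=
  Tendsto (fun ℓ : ℕ => treeMarginal Δ lam (2 * ℓ + 1)) atTop (𝓝 p)

/-- The critical activity `(Δ - 1) ^ (Δ - 1) / (Δ - 2) ^ Δ` of the infinite `Δ`-regular tree
(for `Δ ≥ 3`). -/
noncomputable def criticalActivity (Δ : ℕ) : ℝ :=
  ((Δ : ℝ) - 1) ^ (Δ - 1) / ((Δ : ℝ) - 2) ^ Δ

/-- The entropy function `H`; `0 * log 0` is `0`. -/
noncomputable def entropyH (x : ℝ) : ℝ :=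
  -x * Real.log x - (1 - x) * Real.log (1 - x)

/-- The function `H₁`, on `0 ≤ x ≤ y`; `0 * log 0` is `0`. -/
noncomputable def entropyH1 (x y : ℝ) : ℝ :=
  -x * (Real.log x - Real.log y) + (x - y) * (Real.log (y - x) - Real.log y)

/-- The exponent `Φ₂(α, β, γ, δ, ε)` of the second moment, for degree `Δ` and activity `lam`. -/
noncomputable def Phi2 (Δ : ℕ) (lam α β γ δ ε : ℝ) : ℝ :=
  2 * (α + β) * Real.log lam
    + entropyH α + entropyH1 γ α + entropyH1 (α - γ) (1 - α)
    + entropyH β + entropyH1 δ β + entropyH1 (β - δ) (1 - β)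
    + (Δ : ℝ) *
      (entropyH1 γ (1 - 2 * β + δ) - entropyH γ
        + entropyH1 ε (1 - 2 * β + δ - γ)
        + entropyH1 (α - γ - ε) (β - δ)
        - entropyH1 (α - γ) (1 - γ)
        + entropyH1 (α - γ) (1 - β - γ - ε)
        - entropyH1 (α - γ) (1 - α))

/-- The region of all `(γ, δ, ε)` on which `Φ₂(α, β, ·)` is considered. If it is nonempty then
`α, β ≥ 0` and `α + β ≤ 1`. -/
def overlapRegion (α β : ℝ) : Set (ℝ × ℝ × ℝ) :=
  {x | match x with
    | (γ, δ, ε) =>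
      0 ≤ γ ∧ 0 ≤ δ ∧ 0 ≤ ε ∧ 0 ≤ α - γ - ε ∧ 0 ≤ β - δ ∧
      0 ≤ 1 - 2 * β + δ - γ - ε ∧ 0 ≤ 1 - α - β - ε ∧ 0 ≤ β - δ + ε + γ - α}

/-- On the set `S`, the function `g` attains its maximum at `a` and nowhere else. -/
def IsUniqueMaxOn {X : Type*} (g : X → ℝ) (S : Set X) (a : X) : Prop :=
  a ∈ S ∧ ∀ x ∈ S, x ≠ a → g x < g a

/-! `Phi2` has Bethe form: `Δ` times the entropy of a pair of configurations on an edge, minus `Δ -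
1` times its entropies at the two endpoints, plus the energy. Write F for the first-moment exponent,
which has the same form for one configuration. Reveal the first configuration on the edge: left end
occupied (mass α), right end occupied (β), or neither. The chain rule for entropy, together with the
fact that conditioning on the whole edge lowers the conditional entropy at an endpoint, gives
`Phi2_le`: `Phi2` ≤ F(α,β) + the average of F over the three conditional laws ("rows") of the second
configuration. At the product point all rows equal (α,β) and `Phi2` = 2F(α,β) (`Phi2_product`).

The tree recursion gives λ = 1/(qr) with q + r = 1 and r < q, and p⁺, p⁻ are q² and r² over 1 - qr.
A Gibbs bound in fugacity coordinates followed by a Hölder-type polynomial inequality shows that F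
has no maximisers but (p⁺,p⁻) and its swap (`firstMomentExponent_le`). At (α,β) = (p⁺,p⁻) a
competitor of the product point must therefore have every row at one of these two points. No row has
first coordinate above p⁺ while their average is p⁺, so all rows are (p⁺,p⁻), which is the product
point.

For nearby (α,β) this global argument is unavailable, since (α,β) need not maximise F. By
compactness and continuity, competitors for parameters tending to (p⁺,p⁻) accumulate at the product
point, so eventually their rows are near (p⁺,p⁻). There the Hessian of F is negative definite, so F
lies strictly below its tangent plane at (α,β). The rows average to (α,β), so the linear terms
cancel and the rows must be constant. -/

open Real in
/-- The exponent of the first moment for degree `3`. -/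
noncomputable def firstMomentExponent (lam a b : ℝ) : ℝ :=
  (a + b) * log lam + negMulLog a + negMulLog b + 3 * negMulLog (1 - a - b)
    - 2 * negMulLog (1 - a) - 2 * negMulLog (1 - b)

/-! ### Entropy inequalities. -/

theorem entropyH_eq (x : ℝ) : entropyH x = Real.negMulLog x + Real.negMulLog (1 - x) := by
  simp only [entropyH, Real.negMulLog]; ring

theorem entropyH1_eq (x y : ℝ) :
    entropyH1 x y = Real.negMulLog x + Real.negMulLog (y - x) - Real.negMulLog y := by
  simp only [entropyH1, Real.negMulLog]; ring

/-- This is log x ≤ x - 1 at x = w/p, one summand of Gibbs' inequality. The condition at w = 0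
guards against the convention log 0 = 0, where the true left side would be -∞. -/
theorem mul_log_add_negMulLog_le {p w : ℝ} (hp : 0 ≤ p) (hw : 0 ≤ w) (h : w = 0 → p = 0) :
    p * Real.log w + Real.negMulLog p ≤ w - p := by
  rcases hp.eq_or_lt with rfl | hp
  · simpa using hw
  have hw' : 0 < w := lt_of_le_of_ne hw fun h0 => hp.ne' (h h0.symm)
  have := Real.log_le_sub_one_of_pos (div_pos hw' hp)
  rw [Real.log_div hw'.ne' hp.ne'] at this
  have h2 := mul_le_mul_of_nonneg_left this hp.le
  have h3 : p * (w / p - 1) = w - p := by field_simp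
  rw [h3] at h2
  simp only [Real.negMulLog]
  linarith

/-- Gibbs' inequality for a two-point distribution, unnormalised. -/
theorem negMulLog_add_sub_le {x y X Y : ℝ} (hx : 0 ≤ x) (hy : 0 ≤ y) (hX : x ≤ X) (hY : y ≤ Y) :
    Real.negMulLog x + Real.negMulLog y - Real.negMulLog (x + y) ≤
      x * (Real.log (X + Y) - Real.log X) + y * (Real.log (X + Y) - Real.log Y) := by
  rcases (add_nonneg hx hy).eq_or_lt with h | hn
  · have h1 : x = 0 := by linarith
    have h2 : y = 0 := by linarith
    simp [h1, h2]
  have hS : 0 < X + Y := by linarith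
  have key : ∀ z Z : ℝ, 0 ≤ z → z ≤ Z →
      z * (Real.log (x + y) + Real.log Z - Real.log (X + Y)) + Real.negMulLog z ≤
        (x + y) * Z / (X + Y) - z := by
    intro z Z hz hZ
    rcases (hz.trans hZ).eq_or_lt with h | hZ0
    · have : z = 0 := by linarith
      subst this; simp [← h]
    · have := mul_log_add_negMulLog_le (p := z) (w := (x + y) * Z / (X + Y)) hz (by positivity)
        (fun h0 => absurd h0 (by positivity))
      rwa [Real.log_div (by positivity) hS.ne', Real.log_mul hn.ne' hZ0.ne'] at this
  have k1 := key x X hx hX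
  have k2 := key y Y hy hY
  have e : (x + y) * X / (X + Y) + (x + y) * Y / (X + Y) = x + y := by field_simp
  have e2 : Real.negMulLog (x + y) = -(x + y) * Real.log (x + y) := rfl
  rw [e2]
  linarith

/-- Concavity of the conditional entropy of a two-point distribution. -/
theorem condEntropy_superadditive {x₁ y₁ x₂ y₂ : ℝ} (hx₁ : 0 ≤ x₁) (hy₁ : 0 ≤ y₁) (hx₂ : 0 ≤ x₂)
    (hy₂ : 0 ≤ y₂) :
    (Real.negMulLog x₁ + Real.negMulLog y₁ - Real.negMulLog (x₁ + y₁))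
      + (Real.negMulLog x₂ + Real.negMulLog y₂ - Real.negMulLog (x₂ + y₂)) ≤
    Real.negMulLog (x₁ + x₂) + Real.negMulLog (y₁ + y₂)
      - Real.negMulLog (x₁ + x₂ + (y₁ + y₂)) := by
  -- Both parts are compared with the same merged distribution, so the two cross-entropies add up to
  -- exactly its entropy.
  have h1 := negMulLog_add_sub_le hx₁ hy₁ (le_add_of_nonneg_right hx₂) (le_add_of_nonneg_right hy₂)
  have h2 := negMulLog_add_sub_le hx₂ hy₂ (le_add_of_nonneg_left hx₁) (le_add_of_nonneg_left hy₁)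
  refine (add_le_add h1 h2).trans_eq ?_
  simp only [Real.negMulLog]; ring

/-! ### The second moment bounded by conditional first moments. -/

/-- Clears the denominators of a row of mass P. The extra `negMulLog P` arises because the entropy
arguments, counted with their coefficients, sum to -P. -/
theorem mul_firstMomentExponent (lam : ℝ) {P a b c : ℝ} (hP : 0 < P) (h : a + b + c = P) :
    P * firstMomentExponent lam (a / P) (b / P) =
      (a + b) * Real.log lam + Real.negMulLog a + Real.negMulLog b + 3 * Real.negMulLog c
        - 2 * Real.negMulLog (b + c) - 2 * Real.negMulLog (a + c) + Real.negMulLog P := by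
  obtain ⟨a', rfl⟩ : ∃ a', a = P * a' := ⟨a / P, by field_simp⟩
  obtain ⟨b', rfl⟩ : ∃ b', b = P * b' := ⟨b / P, by field_simp⟩
  obtain rfl : c = P * (1 - a' - b') := by linarith
  have e1 : P * b' + P * (1 - a' - b') = P * (1 - a') := by ring
  have e2 : P * a' + P * (1 - a' - b') = P * (1 - b') := by ring
  rw [e1, e2, mul_div_cancel_left₀ _ hP.ne', mul_div_cancel_left₀ _ hP.ne']
  simp only [Real.negMulLog_mul, firstMomentExponent]
  ring

/-- Chain rule for two independent splittings: dividing u and v in the same ratio t costs the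
entropy of dividing u + v once. This lets `Phi2` be rewritten through the nine cells of a joint edge
law. -/
theorem negMulLog_split (t u v : ℝ) :
    Real.negMulLog (t * u) + Real.negMulLog (t * v) + Real.negMulLog ((1 - t) * u)
      + Real.negMulLog ((1 - t) * v) =
    Real.negMulLog u + Real.negMulLog v + Real.negMulLog (t * (u + v))
      + Real.negMulLog ((1 - t) * (u + v)) - Real.negMulLog (u + v) := by
  simp only [Real.negMulLog_mul]; ring

/-- The fraction of the remaining admissible partners that are matched to vertices occupied only in
the second configuration. -/
noncomputable def matchRatio (α β γ ε : ℝ) : ℝ := (α - γ) / (1 - β - γ - ε)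

open Real in
-- The Bethe form: the nine edge terms are the joint law of the two configurations on an edge, and
-- the last two lines are its marginals at the endpoints.
theorem Phi2_eq (lam α β γ δ ε t : ℝ) (ht : t * (1 - β - γ - ε) = α - γ) :
    Phi2 3 lam α β γ δ ε = 2 * (α + β) * log lam
      + 3 * (negMulLog γ + negMulLog (α - γ - ε) + negMulLog ε
        + negMulLog (t * (β - δ)) + negMulLog δ + negMulLog ((1 - t) * (β - δ))
        + negMulLog (t * (1 - 2 * β + δ - γ - ε)) + negMulLog (β - δ + ε + γ - α)
        + negMulLog ((1 - t) * (1 - 2 * β + δ - γ - ε)))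
      - 2 * (negMulLog γ + 2 * negMulLog (α - γ) + negMulLog (1 - 2 * α + γ))
      - 2 * (negMulLog δ + 2 * negMulLog (β - δ) + negMulLog (1 - 2 * β + δ)) := by
  have h := negMulLog_split t (1 - 2 * β + δ - γ - ε) (β - δ)
  have e1 : 1 - 2 * β + δ - γ - ε + (β - δ) = 1 - β - γ - ε := by ring
  have e2 : (1 - t) * (1 - β - γ - ε) = 1 - α - β - ε := by linarith
  rw [e1, e2, ht] at h
  simp only [Phi2, entropyH_eq, entropyH1_eq, Nat.cast_ofNat]
  have f1 : 1 - α - (α - γ) = 1 - 2 * α + γ := by ring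
  have f2 : 1 - β - (β - δ) = 1 - 2 * β + δ := by ring
  have f3 : β - δ - (α - γ - ε) = β - δ + ε + γ - α := by ring
  have f4 : 1 - γ - (α - γ) = 1 - α := by ring
  have f5 : 1 - β - γ - ε - (α - γ) = 1 - α - β - ε := by ring
  simp only [f1, f2, f3, f4, f5]
  linarith

theorem matchRatio_mul {α β γ δ ε : ℝ} (hx : (γ, δ, ε) ∈ overlapRegion α β) (hγ : γ ≤ α) :
    matchRatio α β γ ε * (1 - β - γ - ε) = α - γ := by
  obtain ⟨h1, h2, h3, h4, h5, h6, h7, h8⟩ := hx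
  -- The denominator is (1 - α - β - ε) + (α - γ), a sum of nonnegative terms; if it vanishes so
  -- does α - γ, and the default value of the quotient is harmless.
  by_cases h : 1 - β - γ - ε = 0
  · rw [h]; linarith
  · exact div_mul_cancel₀ _ h

theorem matchRatio_mem {α β γ δ ε : ℝ} (hx : (γ, δ, ε) ∈ overlapRegion α β) :
    0 ≤ matchRatio α β γ ε ∧ matchRatio α β γ ε ≤ 1 := by
  obtain ⟨h1, h2, h3, h4, h5, h6, h7, h8⟩ := hx
  exact ⟨div_nonneg (by linarith) (by linarith), div_le_one_of_le₀ (by linarith) (by linarith)⟩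

/-- The second moment exponent is at most the one obtained by revealing the second configuration
at an edge conditionally on the first. -/
theorem Phi2_le (lam : ℝ) {α β γ δ ε : ℝ} (hα : 0 < α) (hβ : 0 < β) (ho : 0 < 1 - α - β)
    (hx : (γ, δ, ε) ∈ overlapRegion α β) :
    Phi2 3 lam α β γ δ ε ≤ firstMomentExponent lam α β
      + α * firstMomentExponent lam (γ / α) ((α - γ - ε) / α)
      + β * firstMomentExponent lam (matchRatio α β γ ε * (β - δ) / β) (δ / β)
      + (1 - α - β) * firstMomentExponent lam
          (matchRatio α β γ ε * (1 - 2 * β + δ - γ - ε) / (1 - α - β))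
          ((β - δ + ε + γ - α) / (1 - α - β)) := by
  have hx' := hx
  obtain ⟨h1, h2, h3, h4, h5, h6, h7, h8⟩ := hx
  have ht := matchRatio_mul hx' (by linarith)
  obtain ⟨t0, t1⟩ := matchRatio_mem hx'
  set t := matchRatio α β γ ε
  have hv : 0 ≤ t * (β - δ) := mul_nonneg t0 h5
  have hv' : 0 ≤ (1 - t) * (β - δ) := mul_nonneg (by linarith) h5
  have hu : 0 ≤ t * (1 - 2 * β + δ - γ - ε) := mul_nonneg t0 h6
  have hu' : 0 ≤ (1 - t) * (1 - 2 * β + δ - γ - ε) := mul_nonneg (by linarith) h6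
  rw [mul_firstMomentExponent lam (c := ε) hα (by ring),
    mul_firstMomentExponent lam (c := (1 - t) * (β - δ)) hβ (by ring),
    mul_firstMomentExponent lam (c := (1 - t) * (1 - 2 * β + δ - γ - ε)) ho (by linarith),
    Phi2_eq lam α β γ δ ε t ht]
  -- `cA` merges the two rows in which the left end is unoccupied in the first configuration; `cB`
  -- does the same for the right end.
  have cA := condEntropy_superadditive hv (add_nonneg h2 hv') hu (add_nonneg h8 hu')
  have cB := condEntropy_superadditive h4 (add_nonneg h1 h3) h8 (add_nonneg hu hu')
  have a1 : t * (β - δ) + (δ + (1 - t) * (β - δ)) = β := by ring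
  have a2 : t * (1 - 2 * β + δ - γ - ε)
      + (β - δ + ε + γ - α + (1 - t) * (1 - 2 * β + δ - γ - ε)) = 1 - α - β := by linarith
  have a3 : t * (β - δ) + t * (1 - 2 * β + δ - γ - ε) = α - γ := by linarith
  have a4 : δ + (1 - t) * (β - δ)
      + (β - δ + ε + γ - α + (1 - t) * (1 - 2 * β + δ - γ - ε)) = 1 - 2 * α + γ := by linarith
  have a5 : α - γ + (1 - 2 * α + γ) = 1 - α := by ring
  have b1 : α - γ - ε + (γ + ε) = α := by ring
  have b2 : β - δ + ε + γ - α + (t * (1 - 2 * β + δ - γ - ε)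
      + (1 - t) * (1 - 2 * β + δ - γ - ε)) = 1 - α - β := by linarith
  have b3 : α - γ - ε + (β - δ + ε + γ - α) = β - δ := by ring
  have b4 : γ + ε + (t * (1 - 2 * β + δ - γ - ε)
      + (1 - t) * (1 - 2 * β + δ - γ - ε)) = 1 - 2 * β + δ := by linarith
  have b5 : β - δ + (1 - 2 * β + δ) = 1 - β := by ring
  have c1 : α - γ - ε + ε = α - γ := by ring
  have c2 : t * (β - δ) + (1 - t) * (β - δ) = β - δ := by ring
  rw [a1, a2, a3, a4, a5] at cA
  rw [b1, b2, b3, b4, b5] at cB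
  rw [c1, c2]
  have hl : (γ + (α - γ - ε)) * Real.log lam + (t * (β - δ) + δ) * Real.log lam
      + (t * (1 - 2 * β + δ - γ - ε) + (β - δ + ε + γ - α)) * Real.log lam
      = (α + β) * Real.log lam := by
    rw [← add_mul, ← add_mul]; congr 1; linarith
  simp only [firstMomentExponent]
  linarith

theorem product_mem_overlapRegion {α β : ℝ} (hα : 0 < α) (hβ : 0 < β) (ho : 0 < 1 - α - β) :
    (α ^ 2, β ^ 2, α * (1 - α - β)) ∈ overlapRegion α β := by
  refine ⟨by positivity, by positivity, by positivity, ?_, ?_, ?_, ?_, ?_⟩ <;> nlinarith [mul_pos hα hβ, mul_pos hα ho, mul_pos hβ ho, mul_pos ho ho]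

/-- Here the two configurations are independent on the edge, so entropies add. -/
theorem Phi2_product (lam : ℝ) {α β : ℝ} (hα : 0 < α) (ho : 0 < 1 - α - β) :
    Phi2 3 lam α β (α ^ 2) (β ^ 2) (α * (1 - α - β)) = 2 * firstMomentExponent lam α β := by
  have hβ : 1 - β ≠ 0 := by linarith
  -- The ratio is the probability that the left end is occupied given that the right end is not.
  rw [Phi2_eq lam α β _ _ _ (α / (1 - β)) (by field_simp; ring)]
  have e1 : α - α ^ 2 - α * (1 - α - β) = α * β := by ring
  have e2 : α / (1 - β) * (β - β ^ 2) = α * β := by field_simp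
  have e3 : (1 - α / (1 - β)) * (β - β ^ 2) = β * (1 - α - β) := by field_simp; ring
  have e4 : α / (1 - β) * (1 - 2 * β + β ^ 2 - α ^ 2 - α * (1 - α - β)) = α * (1 - α - β) := by
    field_simp; ring
  have e5 : (1 - α / (1 - β)) * (1 - 2 * β + β ^ 2 - α ^ 2 - α * (1 - α - β)) =
      (1 - α - β) * (1 - α - β) := by field_simp; ring
  have e6 : β - β ^ 2 + α * (1 - α - β) + α ^ 2 - α = (1 - α - β) * β := by ring
  have e7 : α - α ^ 2 = α * (1 - α) := by ring
  have e8 : β - β ^ 2 = β * (1 - β) := by ring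
  have e9 : 1 - 2 * α + α ^ 2 = (1 - α) * (1 - α) := by ring
  have e10 : 1 - 2 * β + β ^ 2 = (1 - β) * (1 - β) := by ring
  rw [e1, e2, e3, e4, e5, e6, e7, e8, e9, e10]
  simp only [pow_two, Real.negMulLog_mul, firstMomentExponent]
  ring

/-! ### The global maximum of the first moment exponent. -/

/-- Cubed Hölder inequality with exponents 3/2 and 3 for the vectors (1, (cY³)^(2/3)) and (c^(2/3)A,
1). The difference of the sides is a square times a positive factor, which also settles equality. -/
theorem holder_two_point {c A Y : ℝ} (hc : 0 < c) (hA : 0 < A) (hY : 0 ≤ Y) :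
    c ^ 2 * (A + Y ^ 2) ^ 3 ≤ (1 + c * Y ^ 3) ^ 2 * (c ^ 2 * A ^ 3 + 1) ∧
      (c ^ 2 * (A + Y ^ 2) ^ 3 = (1 + c * Y ^ 3) ^ 2 * (c ^ 2 * A ^ 3 + 1) → c * Y * A = 1) := by
  have key : (1 + c * Y ^ 3) ^ 2 * (c ^ 2 * A ^ 3 + 1) - c ^ 2 * (A + Y ^ 2) ^ 3 =
      (c * Y * A - 1) ^ 2 * (c ^ 2 * A * Y ^ 4 + 2 * c * Y ^ 3 + 2 * c * A * Y + 1) := by ring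
  have hpos : 0 < c ^ 2 * A * Y ^ 4 + 2 * c * Y ^ 3 + 2 * c * A * Y + 1 := by positivity
  refine ⟨by nlinarith [mul_nonneg (sq_nonneg (c * Y * A - 1)) hpos.le], fun h => ?_⟩
  rw [h, sub_self] at key
  rcases mul_eq_zero.mp key.symm with h | h
  · linarith [pow_eq_zero_iff (two_ne_zero) |>.mp h]
  · linarith

/-- Eliminates Y by the two-point inequality with A = 1 + X²; the remaining inequality in X again
differs by a square times a positive factor. -/
theorem hardcore_norm_inequality {c X Y : ℝ} (hc : 0 < c) (hc1 : c < 1) (hX : 0 ≤ X)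
    (hY : 0 ≤ Y) :
    c ^ 2 * (1 - c ^ 2) * (1 + X ^ 2 + Y ^ 2) ^ 3 ≤ (1 + c * X ^ 3) ^ 2 * (1 + c * Y ^ 3) ^ 2 ∧
      (c ^ 2 * (1 - c ^ 2) * (1 + X ^ 2 + Y ^ 2) ^ 3 = (1 + c * X ^ 3) ^ 2 * (1 + c * Y ^ 3) ^ 2 →
        c * X ^ 2 - X + c = 0 ∧ c * Y * (1 + X ^ 2) = 1) := by
  obtain ⟨h1, h2⟩ := holder_two_point (A := 1 + X ^ 2) hc (by positivity) hY
  have hc2 : 0 < 1 - c ^ 2 := by nlinarith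
  have key : (1 + c * X ^ 3) ^ 2 - (1 - c ^ 2) * (c ^ 2 * (1 + X ^ 2) ^ 3 + 1) =
      (c * X ^ 2 - X + c) ^ 2 * (c ^ 2 * X ^ 2 + 2 * c * X + c ^ 2) := by ring
  have hpos : 0 < c ^ 2 * X ^ 2 + 2 * c * X + c ^ 2 := by positivity
  have hY2 : 0 < (1 + c * Y ^ 3) ^ 2 := by positivity
  have h3 : (1 - c ^ 2) * (c ^ 2 * (1 + X ^ 2) ^ 3 + 1) ≤ (1 + c * X ^ 3) ^ 2 := by
    nlinarith [mul_nonneg (sq_nonneg (c * X ^ 2 - X + c)) hpos.le]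
  have h4 := mul_le_mul_of_nonneg_left h1 hc2.le
  have h5 := mul_le_mul_of_nonneg_left h3 hY2.le
  refine ⟨by linarith, fun h => ⟨?_, ?_⟩⟩
  · have h6 : (1 + c * X ^ 3) ^ 2 = (1 - c ^ 2) * (c ^ 2 * (1 + X ^ 2) ^ 3 + 1) :=
      mul_left_cancel₀ hY2.ne' (by linarith)
    rw [h6, sub_self] at key
    rcases mul_eq_zero.mp key.symm with h | h
    · exact pow_eq_zero_iff (two_ne_zero) |>.mp h
    · linarith
  · exact h2 (mul_left_cancel₀ hc2.ne' (by linarith))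

/-- The fugacity coordinate: `c X³ = a / (1 - a)`. -/
theorem exists_fugacity {c a : ℝ} (hc : 0 < c) (ha : 0 ≤ a) (ha1 : a < 1) :
    ∃ X : ℝ, 0 ≤ X ∧ (1 - a) * (1 + c * X ^ 3) = 1 ∧ (X = 0 → a = 0) ∧
      3 * (a * Real.log (X ^ 2)) = 2 * a * (Real.log a - Real.log (1 - a) - Real.log c) := by
  have h1 : 0 < 1 - a := by linarith
  have hz : 0 ≤ a / ((1 - a) * c) := by positivity
  refine ⟨(a / ((1 - a) * c)) ^ ((3 : ℕ) : ℝ)⁻¹, by positivity, ?_, ?_, ?_⟩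
  · rw [Real.rpow_inv_natCast_pow hz (by norm_num)]
    field_simp; ring
  · intro h
    rw [Real.rpow_eq_zero hz (by norm_num)] at h
    rcases div_eq_zero_iff.mp h with h | h
    · exact h
    · exact absurd h (by positivity)
  · rcases ha.eq_or_lt with rfl | ha
    · simp
    · rw [Real.log_pow, Real.log_rpow (by positivity), Real.log_div ha.ne' (by positivity),
        Real.log_mul h1.ne' hc.ne']
      push_cast; ring

/-- Gibbs' inequality for the edge law (a, b, 1 - a - b) against weights X², Y², 1. With cX³ and cY³
the odds of a and b, the endpoint entropies and the energy cancel up to normalising constants. -/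
theorem firstMomentExponent_le_log {c a b : ℝ} (hc : 0 < c) (ha : 0 ≤ a) (hb : 0 ≤ b)
    (hab : a + b ≤ 1) (ha1 : a < 1) (hb1 : b < 1) :
    ∃ X Y : ℝ, 0 ≤ X ∧ 0 ≤ Y ∧ (1 - a) * (1 + c * X ^ 3) = 1 ∧ (1 - b) * (1 + c * Y ^ 3) = 1 ∧
      firstMomentExponent (1 / c ^ 2) a b ≤
        3 * Real.log (1 + X ^ 2 + Y ^ 2) - 2 * Real.log (1 + c * X ^ 3)
          - 2 * Real.log (1 + c * Y ^ 3) := by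
  obtain ⟨X, hX, hX1, hX0, hXl⟩ := exists_fugacity hc ha ha1
  obtain ⟨Y, hY, hY1, hY0, hYl⟩ := exists_fugacity hc hb hb1
  refine ⟨X, Y, hX, hY, hX1, hY1, ?_⟩
  have hM : 0 < 1 + X ^ 2 + Y ^ 2 := by positivity
  have key : ∀ p w : ℝ, 0 ≤ p → 0 ≤ w → (w = 0 → p = 0) →
      p * Real.log w - p * Real.log (1 + X ^ 2 + Y ^ 2) + Real.negMulLog p ≤
        w / (1 + X ^ 2 + Y ^ 2) - p := by
    intro p w hp hw h
    rcases hw.eq_or_lt with h0 | hw'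
    · rw [h h0.symm, ← h0]; simp
    · have := mul_log_add_negMulLog_le hp (div_nonneg hw hM.le)
        (fun h0 => absurd h0 (by positivity))
      rwa [Real.log_div hw'.ne' hM.ne', mul_sub] at this
  have g1 := key a (X ^ 2) ha (by positivity) (fun h => hX0 (by simpa using h))
  have g2 := key b (Y ^ 2) hb (by positivity) (fun h => hY0 (by simpa using h))
  have g3 := key (1 - a - b) 1 (by linarith) (by norm_num) (fun h => absurd h (by norm_num))
  have e : X ^ 2 / (1 + X ^ 2 + Y ^ 2) + Y ^ 2 / (1 + X ^ 2 + Y ^ 2)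
      + 1 / (1 + X ^ 2 + Y ^ 2) = 1 := by field_simp; ring
  have l1 : Real.log (1 + c * X ^ 3) = - Real.log (1 - a) := by
    rw [eq_neg_iff_add_eq_zero, ← Real.log_mul (by positivity) (by linarith), mul_comm, hX1,
      Real.log_one]
  have l2 : Real.log (1 + c * Y ^ 3) = - Real.log (1 - b) := by
    rw [eq_neg_iff_add_eq_zero, ← Real.log_mul (by positivity) (by linarith), mul_comm, hY1,
      Real.log_one]
  have l3 : Real.log (1 / c ^ 2) = -2 * Real.log c := by
    rw [one_div, Real.log_inv, Real.log_pow]; push_cast; ring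
  rw [l1, l2]
  simp only [Real.log_one, mul_zero] at g3
  simp only [firstMomentExponent, l3, Real.negMulLog] at *
  linarith

/-- The coordinates of the critical points of the first moment exponent. -/
theorem eq_of_fugacity {q r c a b X Y : ℝ} (hq : 0 < q) (hr : 0 < r) (hqr : q + r = 1)
    (hc2 : c ^ 2 = q * r)
    (hX1 : (1 - a) * (1 + c * X ^ 3) = 1) (hY1 : (1 - b) * (1 + c * Y ^ 3) = 1)
    (h1 : c * X ^ 2 - X + c = 0) (h2 : c * Y * (1 + X ^ 2) = 1) (hT : X ^ 2 = q / r) :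
    a = q ^ 2 / (1 - q * r) ∧ b = r ^ 2 / (1 - q * r) := by
  have hD : 0 < 1 - q * r := by nlinarith
  have hXY : X * Y = 1 := by linear_combination h2 - Y * h1
  have hX0 : X ≠ 0 := fun h => by simp [h] at hXY
  have e0 : 1 + q / r = 1 / r := by field_simp; linarith
  have e1 : c * X = q := by
    have : c * X = c ^ 2 * (1 + X ^ 2) := by linear_combination (-c) * h1
    rw [this, hc2, hT, e0]; field_simp
  have e2 : c * Y = r := by
    rw [hT, e0] at h2; field_simp at h2; exact h2
  have e3 : Y ^ 2 = r / q := by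
    have : X ^ 2 * Y ^ 2 = 1 := by rw [← mul_pow, hXY, one_pow]
    rw [hT] at this; field_simp at this ⊢; linarith
  have f1 : 1 + c * X ^ 3 = (1 - q * r) / r := by
    have : c * X ^ 3 = c * X * X ^ 2 := by ring
    rw [this, e1, hT]; field_simp; nlinarith
  have f2 : 1 + c * Y ^ 3 = (1 - q * r) / q := by
    have : c * Y ^ 3 = c * Y * Y ^ 2 := by ring
    rw [this, e2, e3]; field_simp; nlinarith
  rw [f1] at hX1
  rw [f2] at hY1
  field_simp at hX1 hY1
  rw [eq_div_iff hD.ne', eq_div_iff hD.ne']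
  obtain rfl : r = 1 - q := by linarith
  exact ⟨by linear_combination -hX1, by linear_combination -hY1⟩

/-- The maximum of the first moment exponent on the triangle is attained only at the two critical
points. -/
theorem firstMomentExponent_le {q r a b : ℝ} (hq : 0 < q) (hr : 0 < r) (hqr : q + r = 1)
    (ha : 0 ≤ a) (hb : 0 ≤ b) (hab : a + b ≤ 1) :
    firstMomentExponent (1 / (q * r)) a b ≤ - Real.log (q * r * (1 - q * r)) ∧
      (firstMomentExponent (1 / (q * r)) a b = - Real.log (q * r * (1 - q * r)) →
        a = q ^ 2 / (1 - q * r) ∧ b = r ^ 2 / (1 - q * r) ∨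
        a = r ^ 2 / (1 - q * r) ∧ b = q ^ 2 / (1 - q * r)) := by
  have hs : 0 < q * r := mul_pos hq hr
  have hD : 0 < 1 - q * r := by nlinarith
  -- The corners a = 1 and b = 1 have infinite fugacity, so they are compared directly.
  have hvert : Real.log (1 / (q * r)) < - Real.log (q * r * (1 - q * r)) := by
    rw [Real.log_mul hs.ne' hD.ne', one_div, Real.log_inv]
    have := Real.log_neg hD (by linarith)
    linarith
  by_cases ha1 : a < 1
  swap
  · obtain rfl : a = 1 := by linarith
    obtain rfl : b = 0 := by linarith
    have : firstMomentExponent (1 / (q * r)) 1 0 = Real.log (1 / (q * r)) := by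
      simp [firstMomentExponent]
    rw [this]
    exact ⟨hvert.le, fun h => absurd h hvert.ne⟩
  by_cases hb1 : b < 1
  swap
  · obtain rfl : b = 1 := by linarith
    obtain rfl : a = 0 := by linarith
    have : firstMomentExponent (1 / (q * r)) 0 1 = Real.log (1 / (q * r)) := by
      simp [firstMomentExponent]
    rw [this]
    exact ⟨hvert.le, fun h => absurd h hvert.ne⟩
  have hc : 0 < √(q * r) := Real.sqrt_pos.mpr hs
  have hc2 : √(q * r) ^ 2 = q * r := Real.sq_sqrt hs.le
  set c := √(q * r)
  have hc1 : c < 1 := by nlinarith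
  obtain ⟨X, Y, hX, hY, hX1, hY1, hle⟩ := firstMomentExponent_le_log hc ha hb hab ha1 hb1
  obtain ⟨hin, heq⟩ := hardcore_norm_inequality hc hc1 hX hY
  rw [hc2] at hle hin heq
  have hlhs : 0 < q * r * (1 - q * r) * (1 + X ^ 2 + Y ^ 2) ^ 3 := by positivity
  have l1 : Real.log (q * r * (1 - q * r) * (1 + X ^ 2 + Y ^ 2) ^ 3) =
      Real.log (q * r * (1 - q * r)) + 3 * Real.log (1 + X ^ 2 + Y ^ 2) := by
    rw [Real.log_mul (by positivity) (by positivity), Real.log_pow]; norm_num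
  have l2 : Real.log ((1 + c * X ^ 3) ^ 2 * (1 + c * Y ^ 3) ^ 2) =
      2 * Real.log (1 + c * X ^ 3) + 2 * Real.log (1 + c * Y ^ 3) := by
    rw [Real.log_mul (by positivity) (by positivity), Real.log_pow, Real.log_pow]; norm_num
  have hlog := Real.log_le_log hlhs hin
  rw [l1, l2] at hlog
  refine ⟨by linarith, fun h => ?_⟩
  obtain ⟨k1, k2⟩ := heq (Real.log_injOn_pos (Set.mem_Ioi.mpr hlhs)
    (Set.mem_Ioi.mpr (by positivity)) (by rw [l1, l2]; linarith))
  -- Squaring c(1 + X²) = X gives a quadratic in X² that factors because q + r = 1; its two roots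
  -- are the two critical points.
  have hT : (r * X ^ 2 - q) * (q * X ^ 2 - r) = 0 := by
    have : c ^ 2 * (1 + X ^ 2) ^ 2 = X ^ 2 := by
      linear_combination (c * (1 + X ^ 2) + X) * k1
    rw [hc2] at this
    obtain rfl : r = 1 - q := by linarith
    linear_combination this
  rcases mul_eq_zero.mp hT with h | h
  · exact Or.inl (eq_of_fugacity hq hr hqr hc2 hX1 hY1 k1 k2
      (by rw [eq_div_iff hr.ne']; linarith))
  · have := eq_of_fugacity hr hq (by linarith) (by linarith) hX1 hY1 k1 k2
      (by rw [eq_div_iff hq.ne']; linarith)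
    rw [mul_comm r q] at this
    exact Or.inr this

theorem firstMomentExponent_eq {q r : ℝ} (hq : 0 < q) (hr : 0 < r) (hqr : q + r = 1) :
    firstMomentExponent (1 / (q * r)) (q ^ 2 / (1 - q * r)) (r ^ 2 / (1 - q * r)) =
      - Real.log (q * r * (1 - q * r)) := by
  have hD : 0 < 1 - q * r := by nlinarith
  have e1 : 1 - q ^ 2 / (1 - q * r) = r / (1 - q * r) := by
    rw [eq_div_iff hD.ne']; simp only [sub_mul, div_mul_cancel₀ _ hD.ne']
    obtain rfl : r = 1 - q := by linarith
    ring
  have e2 : 1 - r ^ 2 / (1 - q * r) = q / (1 - q * r) := by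
    rw [eq_div_iff hD.ne']; simp only [sub_mul, div_mul_cancel₀ _ hD.ne']
    obtain rfl : r = 1 - q := by linarith
    ring
  have e3 : 1 - q ^ 2 / (1 - q * r) - r ^ 2 / (1 - q * r) = q * r / (1 - q * r) := by
    rw [eq_div_iff hD.ne']; simp only [sub_mul, div_mul_cancel₀ _ hD.ne']
    obtain rfl : r = 1 - q := by linarith
    ring
  rw [firstMomentExponent, e3, e1, e2]
  simp only [Real.negMulLog]
  rw [one_div, Real.log_inv, Real.log_mul (mul_pos hq hr).ne' hD.ne',
    Real.log_div (by positivity) hD.ne', Real.log_div (by positivity) hD.ne',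
    Real.log_div (by positivity) hD.ne', Real.log_div (by positivity) hD.ne',
    Real.log_div (by positivity) hD.ne', Real.log_mul hq.ne' hr.ne', Real.log_pow, Real.log_pow]
  push_cast
  field_simp
  obtain rfl : r = 1 - q := by linarith
  ring

/-! ### Strict concavity near the critical point. -/

theorem exists_log_sub_eq {x y : ℝ} (hx : 0 < x) (hy : 0 < y) :
    ∃ ξ ∈ Set.uIcc x y, Real.log y - Real.log x = (y - x) / ξ := by
  wlog h : x ≤ y generalizing x y
  · obtain ⟨ξ, h1, h2⟩ := this hy hx (le_of_not_ge h)
    exact ⟨ξ, Set.uIcc_comm y x ▸ h1, by rw [← neg_sub, h2, ← neg_div, neg_sub]⟩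
  rcases h.eq_or_lt with rfl | h
  · exact ⟨x, Set.left_mem_uIcc, by simp⟩
  obtain ⟨ξ, hξ, e⟩ := exists_hasDerivAt_eq_slope Real.log (fun z => z⁻¹) h
    (Real.continuousOn_log.mono fun z hz => (hx.trans_le hz.1).ne')
    (fun z hz => Real.hasDerivAt_log (hx.trans hz.1).ne')
  refine ⟨ξ, Set.Icc_subset_uIcc (Set.Ioo_subset_Icc_self hξ), ?_⟩
  have h1 : ξ ≠ 0 := (hx.trans hξ.1).ne'
  have h2 : y - x ≠ 0 := by linarith
  field_simp at e ⊢
  linarith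

/-- Second order Taylor formula for `negMulLog`. -/
theorem exists_negMulLog_eq {x y : ℝ} (hx : 0 < x) (hy : 0 < y) :
    ∃ ξ ∈ Set.uIcc x y, Real.negMulLog y =
      Real.negMulLog x + (-Real.log x - 1) * (y - x) - (y - x) ^ 2 / (2 * ξ) := by
  let f : ℝ → ℝ := fun z => z * Real.log z - z * Real.log x - z
  have hf : ∀ z, 0 < z → HasDerivAt f (Real.log z - Real.log x) z := by
    intro z hz
    have := ((Real.hasDerivAt_mul_log hz.ne').sub ((hasDerivAt_id z).mul_const (Real.log x))).sub
      (hasDerivAt_id z)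
    exact this.congr_deriv (by ring)
  have hg : ∀ z, HasDerivAt (fun z : ℝ => (z - x) ^ 2) (2 * (z - x)) z := by
    intro z
    have := ((hasDerivAt_id z).sub_const x).pow 2
    exact this.congr_deriv (by simp)
  -- Cauchy's mean value theorem against (z - x)²; a second mean value step then turns log c - log x
  -- into (c - x)/ξ.
  have key : ∃ c ∈ Set.uIcc x y, (y ≠ x → c ≠ x) ∧
      (y - x) ^ 2 * (Real.log c - Real.log x) = (f y - f x) * (2 * (c - x)) := by
    rcases lt_trichotomy x y with h | h | h
    · obtain ⟨c, hc, e⟩ := exists_ratio_hasDerivAt_eq_ratio_slope f _ h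
        (fun z hz => (hf z (hx.trans_le hz.1)).continuousAt.continuousWithinAt)
        (fun z hz => hf z (hx.trans hz.1)) _ _
        (fun z hz => (hg z).continuousAt.continuousWithinAt) (fun z _ => hg z)
      refine ⟨c, Set.Icc_subset_uIcc (Set.Ioo_subset_Icc_self hc), fun _ => hc.1.ne', ?_⟩
      rw [← e]; ring
    · exact ⟨x, Set.left_mem_uIcc, fun h' => absurd h.symm h', by simp⟩
    · obtain ⟨c, hc, e⟩ := exists_ratio_hasDerivAt_eq_ratio_slope f _ h
        (fun z hz => (hf z (hy.trans_le hz.1)).continuousAt.continuousWithinAt)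
        (fun z hz => hf z (hy.trans hz.1)) _ _
        (fun z hz => (hg z).continuousAt.continuousWithinAt) (fun z _ => hg z)
      refine ⟨c, Set.Icc_subset_uIcc' (Set.Ioo_subset_Icc_self hc), fun _ => hc.2.ne, ?_⟩
      linear_combination -e
  obtain ⟨c, hc, hcx, e⟩ := key
  have hc0 : 0 < c := (lt_min hx hy).trans_le hc.1
  obtain ⟨ξ, hξ, e2⟩ := exists_log_sub_eq hx hc0
  refine ⟨ξ, Set.uIcc_subset_uIcc_left hc hξ, ?_⟩
  by_cases hxy : y = x
  · simp [hxy]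
  have hcx' : c - x ≠ 0 := sub_ne_zero.mpr (hcx hxy)
  have hξ0 : 0 < ξ := (lt_min hx hc0).trans_le hξ.1
  have e3 : f y - f x = (y - x) ^ 2 / (2 * ξ) := by
    rw [e2] at e
    field_simp at e ⊢
    linarith
  rw [← e3]
  simp only [Real.negMulLog, f]
  ring

theorem quadraticForm_pos {A B C x y : ℝ} (hA : 0 < A) (hdet : C ^ 2 < A * B)
    (h : ¬ (x = 0 ∧ y = 0)) : 0 < A * x ^ 2 + 2 * C * x * y + B * y ^ 2 := by
  have e : A * (A * x ^ 2 + 2 * C * x * y + B * y ^ 2) =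
      (A * x + C * y) ^ 2 + (A * B - C ^ 2) * y ^ 2 := by ring
  refine pos_of_mul_pos_right ?_ hA.le
  rw [e]
  by_cases hy : y = 0
  · have hx : x ≠ 0 := fun hx => h ⟨hx, hy⟩
    subst hy
    have : 0 < (A * x) ^ 2 := by positivity
    simpa using this
  · have : 0 < (A * B - C ^ 2) * y ^ 2 := mul_pos (by linarith) (by positivity)
    positivity

/-- If the Hessian of the first moment exponent is negative definite at `(p, m)`, then near `(p, m)`
the exponent lies strictly below its tangent planes. -/
theorem exists_forall_firstMomentExponent_lt (lam : ℝ) {p m : ℝ} (hp : 0 < p) (hm : 0 < m)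
    (ho : 0 < 1 - p - m) (hA : 0 < 1 / p + 3 / (1 - p - m) - 2 / (1 - p))
    (hdet : (3 / (1 - p - m)) ^ 2 < (1 / p + 3 / (1 - p - m) - 2 / (1 - p)) *
      (1 / m + 3 / (1 - p - m) - 2 / (1 - m))) :
    ∃ η : ℝ, 0 < η ∧ ∀ a b : ℝ, |a - p| < η → |b - m| < η → ∃ La Lb : ℝ, ∀ a' b' : ℝ,
      |a' - p| < η → |b' - m| < η → ¬ (a' = a ∧ b' = b) →
      firstMomentExponent lam a' b' <
        firstMomentExponent lam a b + La * (a' - a) + Lb * (b' - b) := by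
  -- Each of the five entropy terms gets its own Taylor point, so definiteness is needed with the
  -- five arguments varying independently.
  have hev : ∀ᶠ x : ℝ × ℝ × ℝ × ℝ × ℝ in 𝓝 (p, m, 1 - p - m, 1 - p, 1 - m),
      (0 < x.1 ∧ 0 < x.2.1 ∧ 0 < x.2.2.1 ∧ 0 < x.2.2.2.1 ∧ 0 < x.2.2.2.2) ∧
      0 < 1 / x.1 + 3 / x.2.2.1 - 2 / x.2.2.2.1 ∧
      (3 / x.2.2.1) ^ 2 < (1 / x.1 + 3 / x.2.2.1 - 2 / x.2.2.2.1) *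
        (1 / x.2.1 + 3 / x.2.2.1 - 2 / x.2.2.2.2) := by
    have h4 : 0 < 1 - p := by linarith
    have h5 : 0 < 1 - m := by linarith
    refine ((?_ : ∀ᶠ _ in _, _).and (Eventually.and ?_ (Eventually.and ?_
      (Eventually.and ?_ ?_)))).and (Eventually.and ?_ ?_)
    · exact continuousAt_const.eventually_lt (by fun_prop) hp
    · exact continuousAt_const.eventually_lt (by fun_prop) hm
    · exact continuousAt_const.eventually_lt (by fun_prop) ho
    · exact continuousAt_const.eventually_lt (by fun_prop) h4
    · exact continuousAt_const.eventually_lt (by fun_prop) h5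
    · refine continuousAt_const.eventually_lt ?_ hA
      fun_prop (disch := simp; linarith)
    · refine ContinuousAt.eventually_lt ?_ ?_ hdet
      · fun_prop (disch := simp; linarith)
      · fun_prop (disch := simp; linarith)
  obtain ⟨ε, hε, H⟩ := Metric.eventually_nhds_iff.mp hev
  -- Half, because 1 - a - b moves by the sum of both displacements.
  refine ⟨ε / 2, by positivity, fun a b ha hb => ?_⟩
  refine ⟨Real.log lam + (-Real.log a - 1) - 3 * (-Real.log (1 - a - b) - 1)
    + 2 * (-Real.log (1 - a) - 1), Real.log lam + (-Real.log b - 1)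
    - 3 * (-Real.log (1 - a - b) - 1) + 2 * (-Real.log (1 - b) - 1), fun a' b' ha' hb' hne => ?_⟩
  have pos : ∀ a b : ℝ, |a - p| < ε / 2 → |b - m| < ε / 2 →
      0 < a ∧ 0 < b ∧ 0 < 1 - a - b ∧ 0 < 1 - a ∧ 0 < 1 - b := by
    intro a b ha hb
    refine (H (y := (a, b, 1 - a - b, 1 - a, 1 - b)) ?_).1
    rw [abs_lt] at ha hb
    simp only [Prod.dist_eq, Real.dist_eq, max_lt_iff, abs_lt]
    refine ⟨?_, ?_, ?_, ?_, ?_⟩ <;> constructor <;> linarith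
  obtain ⟨a0, b0, o0, na0, nb0⟩ := pos a b ha hb
  obtain ⟨a0', b0', o0', na0', nb0'⟩ := pos a' b' ha' hb'
  obtain ⟨ξ₁, h1, e1⟩ := exists_negMulLog_eq a0 a0'
  obtain ⟨ξ₂, h2, e2⟩ := exists_negMulLog_eq b0 b0'
  obtain ⟨ξ₃, h3, e3⟩ := exists_negMulLog_eq o0 o0'
  obtain ⟨ξ₄, h4, e4⟩ := exists_negMulLog_eq na0 na0'
  obtain ⟨ξ₅, h5, e5⟩ := exists_negMulLog_eq nb0 nb0'
  have near : ∀ {x y z ξ : ℝ}, ξ ∈ Set.uIcc x y → |x - z| < ε → |y - z| < ε → |ξ - z| < ε := by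
    intro x y z ξ hξ hx hy
    rw [abs_lt] at hx hy ⊢
    rcases Set.mem_uIcc.mp hξ with h | h <;> constructor <;> linarith [h.1, h.2]
  obtain ⟨⟨p1, p2, p3, p4, p5⟩, hA', hdet'⟩ := H (y := (ξ₁, ξ₂, ξ₃, ξ₄, ξ₅)) (by
    rw [abs_lt] at ha hb ha' hb'
    simp only [Prod.dist_eq, Real.dist_eq, max_lt_iff]
    refine ⟨near h1 ?_ ?_, near h2 ?_ ?_, near h3 ?_ ?_, near h4 ?_ ?_, near h5 ?_ ?_⟩ <;>
      rw [abs_lt] <;> constructor <;> linarith)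
  have hQ := quadraticForm_pos (x := a' - a) (y := b' - b) hA' hdet'
    (fun h => hne ⟨by linarith [h.1], by linarith [h.2]⟩)
  have eQ : (1 / ξ₁ + 3 / ξ₃ - 2 / ξ₄) * (a' - a) ^ 2 + 2 * (3 / ξ₃) * (a' - a) * (b' - b)
      + (1 / ξ₂ + 3 / ξ₃ - 2 / ξ₅) * (b' - b) ^ 2 =
      2 * ((a' - a) ^ 2 / (2 * ξ₁) + (b' - b) ^ 2 / (2 * ξ₂)
        + 3 * ((1 - a' - b' - (1 - a - b)) ^ 2 / (2 * ξ₃))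
        - 2 * ((1 - a' - (1 - a)) ^ 2 / (2 * ξ₄)) - 2 * ((1 - b' - (1 - b)) ^ 2 / (2 * ξ₅))) := by
    field_simp
    ring
  simp only at hQ
  rw [eQ] at hQ
  simp only [firstMomentExponent, e1, e2, e3, e4, e5]
  linarith

/-- The determinant is a positive multiple of 1 - 4qr = (q - r)², so the two critical points must be
distinct. -/
theorem hessian_negDef {q r : ℝ} (hq : 0 < q) (hr : 0 < r) (hqr : q + r = 1) (hne : q ≠ r) :
    let D := 1 - q * r
    let p := q ^ 2 / D
    let m := r ^ 2 / D
    0 < 1 / p + 3 / (1 - p - m) - 2 / (1 - p) ∧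
    (3 / (1 - p - m)) ^ 2 < (1 / p + 3 / (1 - p - m) - 2 / (1 - p)) *
      (1 / m + 3 / (1 - p - m) - 2 / (1 - m)) := by
  intro D p m
  have hD : 0 < D := by simp only [D]; nlinarith
  have e1 : 1 - p = r / D := by
    simp only [p]; rw [eq_div_iff hD.ne', sub_mul, div_mul_cancel₀ _ hD.ne']
    simp only [D]; obtain rfl : r = 1 - q := by linarith
    ring
  have e2 : 1 - m = q / D := by
    simp only [m]; rw [eq_div_iff hD.ne', sub_mul, div_mul_cancel₀ _ hD.ne']
    simp only [D]; obtain rfl : r = 1 - q := by linarith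
    ring
  have e3 : 1 - p - m = q * r / D := by
    rw [e1]; simp only [m]; rw [← sub_div]; congr 1
    obtain rfl : r = 1 - q := by linarith
    ring
  rw [e3, e1, e2]
  have eA : 1 / p + 3 / (q * r / D) - 2 / (r / D) = D * (1 + 2 * (q * r)) / (q ^ 2 * r) := by
    simp only [p]; field_simp
    obtain rfl : r = 1 - q := by linarith
    ring
  have eB : 1 / m + 3 / (q * r / D) - 2 / (q / D) = D * (1 + 2 * (q * r)) / (r ^ 2 * q) := by
    simp only [m]; field_simp
    obtain rfl : r = 1 - q := by linarith
    ring
  rw [eA, eB]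
  refine ⟨by positivity, ?_⟩
  have hs : 0 < q * r := mul_pos hq hr
  have h4 : 0 < 1 - 4 * (q * r) := by
    have : 0 < (q - r) ^ 2 := by
      have := sub_ne_zero.mpr hne
      positivity
    nlinarith
  have e : D * (1 + 2 * (q * r)) / (q ^ 2 * r) * (D * (1 + 2 * (q * r)) / (r ^ 2 * q)) -
      (3 / (q * r / D)) ^ 2 = D ^ 2 * ((1 - q * r) * (1 - 4 * (q * r))) / (q * r) ^ 3 := by
    field_simp
    ring
  have : 0 < D ^ 2 * ((1 - q * r) * (1 - 4 * (q * r))) / (q * r) ^ 3 := by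
    have : 0 < 1 - q * r := hD
    positivity
  linarith

/-! ### The hard-core recursion on trees. -/

namespace RootedGraph

open scoped Classical in
/-- The weight of the independent sets avoiding the root. -/
noncomputable def unoccupiedWeight (T : RootedGraph) (lam : ℝ) : ℝ :=
  ∑ S ∈ Finset.univ.filter (fun S : Finset T.V =>
      T.graph.IsIndepSet (S : Set T.V) ∧ T.root ∉ S), lam ^ S.card

open scoped Classical in
/-- The weight of the independent sets containing the root. -/
noncomputable def occupiedWeight (T : RootedGraph) (lam : ℝ) : ℝ :=
  ∑ S ∈ Finset.univ.filter (fun S : Finset T.V =>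
      T.graph.IsIndepSet (S : Set T.V) ∧ T.root ∈ S), lam ^ S.card

theorem partitionFunction_eq (T : RootedGraph) (lam : ℝ) :
    T.partitionFunction lam = T.occupiedWeight lam + T.unoccupiedWeight lam := by
  classical
  rw [partitionFunction, occupiedWeight, unoccupiedWeight, ← Finset.filter_filter,
    ← Finset.filter_filter, Finset.sum_filter_add_sum_filter_not]

theorem occupiedWeight_nonneg (T : RootedGraph) {lam : ℝ} (h : 0 < lam) :
    0 ≤ T.occupiedWeight lam := Finset.sum_nonneg fun _ _ => by positivity

theorem unoccupiedWeight_pos (T : RootedGraph) {lam : ℝ} (h : 0 < lam) :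
    0 < T.unoccupiedWeight lam := by
  classical
  exact Finset.sum_pos (fun _ _ => by positivity) ⟨∅, by simp [SimpleGraph.IsIndepSet]⟩

theorem partitionFunction_pos (T : RootedGraph) {lam : ℝ} (h : 0 < lam) :
    0 < T.partitionFunction lam := by
  rw [partitionFunction_eq]
  exact add_pos_of_nonneg_of_pos (T.occupiedWeight_nonneg h) (T.unoccupiedWeight_pos h)

theorem one_sub_rootMarginal (T : RootedGraph) {lam : ℝ} (h : 0 < lam) :
    1 - T.rootMarginal lam = T.unoccupiedWeight lam / T.partitionFunction lam := by
  have := T.partitionFunction_pos h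
  change 1 - T.occupiedWeight lam / _ = _
  rw [eq_div_iff this.ne', sub_mul, div_mul_cancel₀ _ this.ne', partitionFunction_eq]
  ring

/-- The vertex set of a graft that meets the `i`-th copy in `S i`. -/
def graftSet {d : ℕ} {V : Type} (S : Fin d → Finset V) : Finset (Fin d × V) :=
  (Finset.univ.sigma S).map ⟨fun x => (x.1, x.2), fun x y h => by
    cases x; cases y; simp only [Prod.mk.injEq] at h; obtain ⟨rfl, rfl⟩ := h; rfl⟩

theorem mem_graftSet {d : ℕ} {V : Type} {S : Fin d → Finset V} {x : Fin d × V} :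
    x ∈ graftSet S ↔ x.2 ∈ S x.1 := by
  obtain ⟨i, v⟩ := x
  simp only [graftSet, Finset.mem_map, Finset.mem_sigma, Finset.mem_univ, true_and]
  constructor
  · rintro ⟨⟨j, w⟩, h, e⟩
    cases e
    exact h
  · intro h
    exact ⟨⟨i, v⟩, h, rfl⟩

theorem card_graftSet {d : ℕ} {V : Type} (S : Fin d → Finset V) :
    (graftSet S).card = ∑ i, (S i).card := by
  rw [graftSet, Finset.card_map, Finset.card_sigma]

theorem sum_prod_eq {d : ℕ} {V : Type} [Fintype V] (lam : ℝ) (P : Finset V → Prop)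
    [DecidablePred P] :
    (∑ S ∈ Finset.univ.filter P, lam ^ S.card) ^ d =
      ∑ S ∈ Finset.univ.filter (fun S : Fin d → Finset V => ∀ i, P (S i)),
        lam ^ (graftSet S).card := by
  classical
  have h := Finset.prod_univ_sum (fun _ : Fin d => Finset.univ.filter P)
    (fun _ (S : Finset V) => lam ^ S.card)
  rw [Finset.prod_const, Finset.card_univ, Fintype.card_fin] at h
  rw [h]
  refine Finset.sum_congr ?_ fun S _ => ?_
  · ext S; simp [Fintype.mem_piFinset]
  · rw [card_graftSet, Finset.prod_pow_eq_pow_sum]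

/-- The part of a set of vertices that lies in the `i`-th copy. -/
def slice {d : ℕ} {V : Type} [Fintype V] [DecidableEq V] (S : Finset (Option (Fin d × V)))
    (i : Fin d) : Finset V := Finset.univ.filter fun v => some (i, v) ∈ S

theorem mem_slice {d : ℕ} {V : Type} [Fintype V] [DecidableEq V]
    {S : Finset (Option (Fin d × V))} {i : Fin d} {v : V} :
    v ∈ slice S i ↔ some (i, v) ∈ S := by simp [slice]

/-- A set avoiding the new root is the same as a family of slices, and the weights multiply. The
analogue with the root included gains one factor `lam`. -/
theorem sum_filter_none_notMem {d : ℕ} {V : Type} [Fintype V] [DecidableEq V] (lam : ℝ)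
    (P : Finset V → Prop) {_ : DecidablePred P}
    {Q : Finset (Option (Fin d × V)) → Prop} {_ : DecidablePred Q}
    (hQ : ∀ S, Q S ↔ (∀ i, P (slice S i)) ∧ none ∉ S) :
    ∑ S ∈ Finset.univ.filter Q, lam ^ S.card =
      (∑ S ∈ Finset.univ.filter P, lam ^ S.card) ^ d := by
  rw [sum_prod_eq]
  have right_inv : ∀ S : Fin d → Finset V,
      slice ((graftSet S).map Function.Embedding.some) = S := fun S => by
    ext i v; simp [mem_graftSet, mem_slice]
  have left_inv : ∀ S : Finset (Option (Fin d × V)), none ∉ S →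
      (graftSet (slice S)).map Function.Embedding.some = S := fun S h0 => by
    ext x
    rcases x with _ | x
    · simp [h0]
    · simp [mem_graftSet, mem_slice]
  refine Finset.sum_bij' (fun S _ => slice S)
    (fun S _ => (graftSet S).map Function.Embedding.some) ?_ ?_ ?_ ?_ ?_
  · intro S hS
    rw [Finset.mem_filter] at hS ⊢
    exact ⟨Finset.mem_univ _, ((hQ S).mp hS.2).1⟩
  · intro S hS
    rw [Finset.mem_filter] at hS ⊢
    exact ⟨Finset.mem_univ _, (hQ _).mpr ⟨by rw [right_inv]; exact hS.2, by simp⟩⟩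
  · intro S hS
    exact left_inv S ((hQ S).mp (Finset.mem_filter.mp hS).2).2
  · intro S _
    exact right_inv S
  · intro S hS
    conv_lhs => rw [← left_inv S ((hQ S).mp (Finset.mem_filter.mp hS).2).2]
    rw [Finset.card_map]

theorem sum_filter_none_mem {d : ℕ} {V : Type} [Fintype V] [DecidableEq V] (lam : ℝ)
    (P : Finset V → Prop) {_ : DecidablePred P}
    {Q : Finset (Option (Fin d × V)) → Prop} {_ : DecidablePred Q}
    (hQ : ∀ S, Q S ↔ (∀ i, P (slice S i)) ∧ none ∈ S) :
    ∑ S ∈ Finset.univ.filter Q, lam ^ S.card =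
      lam * (∑ S ∈ Finset.univ.filter P, lam ^ S.card) ^ d := by
  rw [sum_prod_eq, Finset.mul_sum]
  have right_inv : ∀ S : Fin d → Finset V, slice (Finset.insertNone (graftSet S)) = S :=
    fun S => by ext i v; simp [mem_graftSet, mem_slice]
  have left_inv : ∀ S : Finset (Option (Fin d × V)), none ∈ S →
      Finset.insertNone (graftSet (slice S)) = S := fun S h0 => by
    ext x
    rcases x with _ | x
    · simp [h0]
    · simp [mem_graftSet, mem_slice]
  refine Finset.sum_bij' (fun S _ => slice S)
    (fun S _ => Finset.insertNone (graftSet S)) ?_ ?_ ?_ ?_ ?_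
  · intro S hS
    rw [Finset.mem_filter] at hS ⊢
    exact ⟨Finset.mem_univ _, ((hQ S).mp hS.2).1⟩
  · intro S hS
    rw [Finset.mem_filter] at hS ⊢
    exact ⟨Finset.mem_univ _, (hQ _).mpr ⟨by rw [right_inv]; exact hS.2, by simp⟩⟩
  · intro S hS
    exact left_inv S ((hQ S).mp (Finset.mem_filter.mp hS).2).2
  · intro S _
    exact right_inv S
  · intro S hS
    conv_lhs => rw [← left_inv S ((hQ S).mp (Finset.mem_filter.mp hS).2).2]
    rw [Finset.card_insertNone, pow_succ, mul_comm]

theorem graft_isIndepSet_iff {d : ℕ} {T : RootedGraph} [DecidableEq T.V]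
    {S : Finset (Option (Fin d × T.V))} :
    (graft d T).graph.IsIndepSet (S : Set (Option (Fin d × T.V))) ↔
      (∀ i, T.graph.IsIndepSet (slice S i : Set T.V)) ∧
        (none ∈ S → ∀ i, T.root ∉ slice S i) := by
  constructor
  · intro h
    refine ⟨fun i v hv w hw hne hadj => ?_, fun h0 i hi => ?_⟩
    · exact h (mem_slice.mp hv) (mem_slice.mp hw)
        (fun e => hne (congrArg Prod.snd (Option.some.inj e))) ⟨rfl, hadj⟩
    · exact h h0 (mem_slice.mp hi) (fun e => Option.noConfusion rfl (heq_of_eq e)) rfl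
  · rintro ⟨h1, h2⟩ x hx y hy hne hadj
    match x, y, hx, hy, hne, hadj with
    | none, none, _, _, hne, _ => exact hne rfl
    | none, some (i, w), hx, hy, _, hadj =>
      obtain rfl : w = T.root := hadj
      exact h2 hx i (mem_slice.mpr hy)
    | some (i, v), none, hx, hy, _, hadj =>
      obtain rfl : v = T.root := hadj
      exact h2 hy i (mem_slice.mpr hx)
    | some (i, v), some (j, w), hx, hy, hne, hadj =>
      obtain ⟨rfl, hadj⟩ : i = j ∧ T.graph.Adj v w := hadj
      exact h1 i (mem_slice.mpr hx) (mem_slice.mpr hy) (fun e => hne (by rw [e])) hadj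

theorem unoccupiedWeight_graft (d : ℕ) (T : RootedGraph) (lam : ℝ) :
    (graft d T).unoccupiedWeight lam = T.partitionFunction lam ^ d := by
  classical
  refine sum_filter_none_notMem (d := d) (V := T.V) lam _ fun S => ?_
  refine (and_congr_left' graft_isIndepSet_iff).trans ?_
  change (_ ∧ _) ∧ none ∉ S ↔ _ ∧ none ∉ S
  tauto

theorem occupiedWeight_graft (d : ℕ) (T : RootedGraph) (lam : ℝ) :
    (graft d T).occupiedWeight lam = lam * T.unoccupiedWeight lam ^ d := by
  classical
  refine sum_filter_none_mem (d := d) (V := T.V) lam _ fun S => ?_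
  refine (and_congr_left' graft_isIndepSet_iff).trans ?_
  change (_ ∧ _) ∧ none ∈ S ↔ _ ∧ none ∈ S
  rw [forall_and]
  tauto

/-- The tree recursion. -/
theorem one_sub_rootMarginal_graft (d : ℕ) (T : RootedGraph) {lam : ℝ} (h : 0 < lam) :
    1 - (graft d T).rootMarginal lam = 1 / (1 + lam * (1 - T.rootMarginal lam) ^ d) := by
  have hZ := T.partitionFunction_pos h
  have hU := T.unoccupiedWeight_pos h
  rw [one_sub_rootMarginal _ h, one_sub_rootMarginal _ h, partitionFunction_eq,
    unoccupiedWeight_graft, occupiedWeight_graft, div_pow]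
  field_simp
  ring

theorem aryTree_succ (b n : ℕ) : aryTree b (n + 1) = graft b (aryTree b n) := rfl

theorem regularTree_succ (Δ n : ℕ) :
    regularTree Δ (n + 1) = graft Δ (aryTree (Δ - 1) n) := rfl

end RootedGraph

/-! ### The limits p⁺ and p⁻. -/

/-- The limit of the complementary marginals along a subsequence determines that of the trees with
one level less. -/
theorem tendsto_one_sub_of_tendsto {lam p : ℝ} (hlam : 0 < lam) (hp : p < 1) {y z : ℕ → ℝ}
    (hy : ∀ n, 0 < y n) (hz : ∀ n, z n = 1 - 1 / (1 + lam * y n ^ 3))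
    (h : Tendsto z atTop (𝓝 p)) :
    ∃ b : ℝ, 0 ≤ b ∧ Tendsto y atTop (𝓝 b) ∧ p = 1 - 1 / (1 + lam * b ^ 3) := by
  -- Inverting the last recursion step transfers convergence from `z` to `y`; continuity of the
  -- inverse needs p < 1.
  have hy3 : ∀ n, y n = (z n / ((1 - z n) * lam)) ^ ((3 : ℕ) : ℝ)⁻¹ := by
    intro n
    have := hy n
    have e : z n / ((1 - z n) * lam) = y n ^ 3 := by
      rw [hz]; field_simp; ring
    rw [e, Real.pow_rpow_inv_natCast this.le (by norm_num)]
  have hlim : Tendsto y atTop (𝓝 ((p / ((1 - p) * lam)) ^ ((3 : ℕ) : ℝ)⁻¹)) := by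
    rw [funext hy3]
    refine Tendsto.rpow_const (h.div ((tendsto_const_nhds.sub h).mul_const lam) ?_)
      (Or.inr (by positivity))
    exact mul_ne_zero (by linarith) hlam.ne'
  have hb : 0 ≤ (p / ((1 - p) * lam)) ^ ((3 : ℕ) : ℝ)⁻¹ :=
    ge_of_tendsto' hlim fun n => (hy n).le
  refine ⟨_, hb, hlim, tendsto_nhds_unique h ?_⟩
  rw [funext hz]
  have : 1 + lam * ((p / ((1 - p) * lam)) ^ ((3 : ℕ) : ℝ)⁻¹) ^ 3 ≠ 0 := by positivity
  exact tendsto_const_nhds.sub (tendsto_const_nhds.div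
    (tendsto_const_nhds.add ((hlim.pow 3).const_mul lam)) this)

/-- Parametrisation of the two limits. -/
theorem exists_limits_eq {lam pPlus pMinus : ℝ} (hlam : 4 < lam)
    (hplus : IsPPlus 3 lam pPlus) (hminus : IsPMinus 3 lam pMinus)
    (hhalf : 1 / 2 ≤ pPlus) (hone : pPlus < 1) :
    ∃ q r : ℝ, 0 < q ∧ 0 < r ∧ q + r = 1 ∧ r < q ∧ lam = 1 / (q * r) ∧
      pPlus = q ^ 2 / (1 - q * r) ∧ pMinus = r ^ 2 / (1 - q * r) := by
  have hl : 0 < lam := by linarith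
  obtain ⟨y, hy⟩ : ∃ y : ℕ → ℝ, ∀ n, y n = 1 - (RootedGraph.aryTree 2 n).rootMarginal lam :=
    ⟨_, fun _ => rfl⟩
  have hypos : ∀ n, 0 < y n := fun n => by
    rw [hy, RootedGraph.one_sub_rootMarginal _ hl]
    exact div_pos (RootedGraph.unoccupiedWeight_pos _ hl) (RootedGraph.partitionFunction_pos _ hl)
  have hysucc : ∀ n, y (n + 1) = 1 / (1 + lam * y n ^ 2) :=
    fun n => by
      rw [hy, hy, RootedGraph.aryTree_succ, RootedGraph.one_sub_rootMarginal_graft 2 _ hl]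
  have htree : ∀ n, treeMarginal 3 lam (n + 1) = 1 - 1 / (1 + lam * y n ^ 3) := fun n => by
    have : 1 - treeMarginal 3 lam (n + 1) = 1 / (1 + lam * y n ^ 3) := by
      rw [treeMarginal, hy, RootedGraph.regularTree_succ,
        RootedGraph.one_sub_rootMarginal_graft 3 _ hl]
    linarith
  have hyle : ∀ n, y n ≤ 1 := fun n => by
    rcases n with _ | n
    · rw [hy, RootedGraph.one_sub_rootMarginal _ hl, RootedGraph.partitionFunction_eq]
      have h1 := RootedGraph.unoccupiedWeight_pos (RootedGraph.aryTree 2 0) hl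
      have h2 := RootedGraph.occupiedWeight_nonneg (RootedGraph.aryTree 2 0) hl
      rw [div_le_one (by linarith)]
      linarith
    · rw [hysucc, div_le_one (by have := hypos n; positivity)]
      have := hypos n
      have : 0 ≤ lam * y n ^ 2 := by positivity
      linarith
  have hm1 : pMinus < 1 := by
    have : pMinus ≤ 1 - 1 / (1 + lam) := by
      refine le_of_tendsto' hminus fun n => ?_
      rw [htree]
      have h1 := pow_le_one₀ (n := 3) (hypos (2 * n)).le (hyle (2 * n))
      have h2 : lam * y (2 * n) ^ 3 ≤ lam := by nlinarith
      have h3 := hypos (2 * n)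
      gcongr
    have : 0 < 1 / (1 + lam) := by positivity
    linarith
  obtain ⟨a, ha0, ha, ea⟩ := tendsto_one_sub_of_tendsto hl hm1 (fun n => hypos (2 * n))
    (fun n => htree (2 * n)) hminus
  -- A regular tree of depth n + 1 is built from binary trees of depth n, so the even limit p⁺ comes
  -- from the odd-depth binary trees.
  have hplus' : Tendsto (fun n => treeMarginal 3 lam (2 * n + 1 + 1)) atTop (𝓝 pPlus) :=
    (hplus.comp (tendsto_add_atTop_nat 1)).congr fun n =>
      congrArg (treeMarginal 3 lam) (by ring)
  obtain ⟨b, hb0, hb, eb⟩ := tendsto_one_sub_of_tendsto hl hone (fun n => hypos (2 * n + 1))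
    (fun n => htree (2 * n + 1)) hplus'
  have hlim : ∀ {u v : ℕ → ℝ} {s t : ℝ}, 0 ≤ s → Tendsto u atTop (𝓝 s) → Tendsto v atTop (𝓝 t) →
      (∀ n, v n = 1 / (1 + lam * u n ^ 2)) → t * (1 + lam * s ^ 2) = 1 := by
    intro u v s t hs hu hv huv
    have hne : 1 + lam * s ^ 2 ≠ 0 := by positivity
    have : Tendsto v atTop (𝓝 (1 / (1 + lam * s ^ 2))) := by
      rw [funext huv]
      exact tendsto_const_nhds.div (tendsto_const_nhds.add ((hu.pow 2).const_mul lam)) hne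
    rw [tendsto_nhds_unique hv this]
    field_simp
  have h1 : b * (1 + lam * a ^ 2) = 1 := hlim ha0 ha hb fun n => hysucc (2 * n)
  have h2 : a * (1 + lam * b ^ 2) = 1 :=
    hlim hb0 hb (ha.comp (tendsto_add_atTop_nat 1)) fun n => hysucc (2 * n + 1)
  have hapos : 0 < a := lt_of_le_of_ne ha0 fun h => by rw [← h] at h2; simp at h2
  have hbpos : 0 < b := lt_of_le_of_ne hb0 fun h => by rw [← h] at h1; simp at h1
  have h2b : 1 ≤ lam * b ^ 3 := by
    have h3 : 0 < 1 + lam * b ^ 3 := by positivity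
    have h4 : 1 / (1 + lam * b ^ 3) ≤ 1 / 2 := by linarith
    rw [div_le_div_iff₀ h3 (by norm_num)] at h4
    linarith
  -- A common limit would satisfy a + λa³ = 1, while p⁺ ≥ 1/2 forces λa³ ≥ 1.
  have hne : a ≠ b := by
    rintro rfl
    nlinarith
  have hab : lam * (a * b) = 1 := by
    have : (a - b) * (1 - lam * (a * b)) = 0 := by linear_combination h2 - h1
    rcases mul_eq_zero.mp this with h | h
    · exact absurd (sub_eq_zero.mp h) hne
    · linarith
  have hsum : b + a = 1 := by linear_combination h2 - b * hab
  have hlam' : lam = 1 / (b * a) := by field_simp; linarith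
  have hlt : a < b := by
    have : a ≤ b ^ 2 := by
      have : a * 1 ≤ a * (lam * b ^ 3) := by gcongr
      have e : a * (lam * b ^ 3) = b ^ 2 := by linear_combination b ^ 2 * hab
      linarith
    nlinarith
  refine ⟨b, a, hbpos, hapos, hsum, hlt, hlam', ?_, ?_⟩
  · have hD : 0 < 1 - b * a := by nlinarith
    rw [eb, hlam']
    have e : 1 + 1 / (b * a) * b ^ 3 = (1 - b * a) / a := by
      field_simp; obtain rfl : a = 1 - b := by linarith
      ring
    rw [e, one_div_div, eq_div_iff hD.ne', sub_mul, div_mul_cancel₀ _ hD.ne']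
    obtain rfl : a = 1 - b := by linarith
    ring
  · have hD : 0 < 1 - b * a := by nlinarith
    rw [ea, hlam']
    have e : 1 + 1 / (b * a) * a ^ 3 = (1 - b * a) / b := by
      field_simp; obtain rfl : a = 1 - b := by linarith
      ring
    rw [e, one_div_div, eq_div_iff hD.ne', sub_mul, div_mul_cancel₀ _ hD.ne']
    obtain rfl : a = 1 - b := by linarith
    ring

/-! ### From rows to the product point. -/

theorem matchRatio_rows {α β γ δ ε : ℝ} (hα : 0 < α) (hβ : 0 < β) (ho : 0 < 1 - α - β)
    (hx : (γ, δ, ε) ∈ overlapRegion α β) :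
    (0 ≤ γ / α ∧ 0 ≤ (α - γ - ε) / α ∧ γ / α + (α - γ - ε) / α ≤ 1) ∧
    (0 ≤ matchRatio α β γ ε * (β - δ) / β ∧ 0 ≤ δ / β ∧
      matchRatio α β γ ε * (β - δ) / β + δ / β ≤ 1) ∧
    (0 ≤ matchRatio α β γ ε * (1 - 2 * β + δ - γ - ε) / (1 - α - β) ∧
      0 ≤ (β - δ + ε + γ - α) / (1 - α - β) ∧
      matchRatio α β γ ε * (1 - 2 * β + δ - γ - ε) / (1 - α - β)
        + (β - δ + ε + γ - α) / (1 - α - β) ≤ 1) := by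
  obtain ⟨t0, t1⟩ := matchRatio_mem hx
  obtain ⟨h1, h2, h3, h4, h5, h6, h7, h8⟩ := hx
  simp only [← add_div, div_le_one hα, div_le_one hβ, div_le_one ho]
  have k1 := mul_le_of_le_one_left h5 t1
  have k2 := mul_le_of_le_one_left h6 t1
  refine ⟨⟨by positivity, by positivity, by linarith⟩, ⟨?_, by positivity, by linarith⟩,
    ⟨?_, by positivity, ?_⟩⟩
  · exact div_nonneg (mul_nonneg t0 h5) hβ.le
  · exact div_nonneg (mul_nonneg t0 h6) ho.le
  · linarith

/-- The rows average to the marginals. -/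
theorem matchRatio_rows_sum {α β γ δ ε : ℝ} (hα : 0 < α) (hβ : 0 < β) (ho : 0 < 1 - α - β)
    (hx : (γ, δ, ε) ∈ overlapRegion α β) :
    α * (γ / α) + β * (matchRatio α β γ ε * (β - δ) / β)
      + (1 - α - β) * (matchRatio α β γ ε * (1 - 2 * β + δ - γ - ε) / (1 - α - β)) = α ∧
    α * ((α - γ - ε) / α) + β * (δ / β)
      + (1 - α - β) * ((β - δ + ε + γ - α) / (1 - α - β)) = β := by
  have ht := matchRatio_mul hx (by obtain ⟨h1, h2, h3, h4, -⟩ := hx; linarith)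
  rw [mul_div_cancel₀ _ hα.ne', mul_div_cancel₀ _ hα.ne', mul_div_cancel₀ _ hβ.ne',
    mul_div_cancel₀ _ hβ.ne', mul_div_cancel₀ _ ho.ne', mul_div_cancel₀ _ ho.ne']
  exact ⟨by linarith, by ring⟩

/-- Constant rows force the product point. -/
theorem eq_product_of_rows {α β γ δ ε : ℝ} (hα : 0 < α) (hβ : 0 < β)
    (h1 : γ / α = α) (h2 : (α - γ - ε) / α = β) (h3 : δ / β = β) :
    (γ, δ, ε) = (α ^ 2, β ^ 2, α * (1 - α - β)) := by
  rw [div_eq_iff hα.ne'] at h1 h2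
  rw [div_eq_iff hβ.ne'] at h3
  simp only [Prod.mk.injEq]
  exact ⟨by linarith, by linarith, by linarith⟩

/-- At the limits of the marginals every maximiser of the second moment exponent is the product
point. -/
theorem eq_product_of_Phi2_le {q r γ δ ε : ℝ} (hr : 0 < r) (hqr : q + r = 1) (hrq : r < q)
    (hx : (γ, δ, ε) ∈ overlapRegion (q ^ 2 / (1 - q * r)) (r ^ 2 / (1 - q * r)))
    (hle : 2 * firstMomentExponent (1 / (q * r)) (q ^ 2 / (1 - q * r)) (r ^ 2 / (1 - q * r)) ≤
      Phi2 3 (1 / (q * r)) (q ^ 2 / (1 - q * r)) (r ^ 2 / (1 - q * r)) γ δ ε)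
    (ho : 0 < 1 - q ^ 2 / (1 - q * r) - r ^ 2 / (1 - q * r)) :
    (γ, δ, ε) = ((q ^ 2 / (1 - q * r)) ^ 2, (r ^ 2 / (1 - q * r)) ^ 2,
      q ^ 2 / (1 - q * r) * (1 - q ^ 2 / (1 - q * r) - r ^ 2 / (1 - q * r))) := by
  have hq : 0 < q := hr.trans hrq
  have hD : 0 < 1 - q * r := by nlinarith
  have hα : 0 < q ^ 2 / (1 - q * r) := by positivity
  have hβ : 0 < r ^ 2 / (1 - q * r) := by positivity
  have hlt : r ^ 2 / (1 - q * r) < q ^ 2 / (1 - q * r) := by gcongr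
  have hmax := firstMomentExponent_eq hq hr hqr
  have hbd := fun a b ha hb hab => firstMomentExponent_le (a := a) (b := b) hq hr hqr ha hb hab
  set lam := 1 / (q * r)
  set K := - Real.log (q * r * (1 - q * r))
  set α := q ^ 2 / (1 - q * r)
  set β := r ^ 2 / (1 - q * r)
  have hT := Phi2_le lam hα hβ ho hx
  obtain ⟨⟨a1, a2, a3⟩, ⟨b1, b2, b3⟩, ⟨o1, o2, o3⟩⟩ := matchRatio_rows hα hβ ho hx
  obtain ⟨s1, -⟩ := matchRatio_rows_sum hα hβ ho hx
  obtain ⟨la, ea⟩ := hbd _ _ a1 a2 a3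
  obtain ⟨lb, eb⟩ := hbd _ _ b1 b2 b3
  obtain ⟨lo, eo⟩ := hbd _ _ o1 o2 o3
  generalize firstMomentExponent lam (γ / α) ((α - γ - ε) / α) = FA at *
  generalize firstMomentExponent lam (matchRatio α β γ ε * (β - δ) / β) (δ / β) = FB at *
  generalize firstMomentExponent lam (matchRatio α β γ ε * (1 - 2 * β + δ - γ - ε) / (1 - α - β))
    ((β - δ + ε + γ - α) / (1 - α - β)) = FO at *
  have ma := mul_le_mul_of_nonneg_left la hα.le
  have mb := mul_le_mul_of_nonneg_left lb hβ.le
  have mo := mul_le_mul_of_nonneg_left lo ho.le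
  -- An average of three values, each at most K, is at least K, and all weights are positive.
  have hFA : FA = K := le_antisymm la (le_of_mul_le_mul_left (by linarith) hα)
  have hFB : FB = K := le_antisymm lb (le_of_mul_le_mul_left (by linarith) hβ)
  have hFO : FO = K := le_antisymm lo (le_of_mul_le_mul_left (by linarith) ho)
  have ua : ∀ {a b : ℝ}, (a = α ∧ b = β ∨ a = β ∧ b = α) → a ≤ α := by
    rintro a b (⟨h, -⟩ | ⟨h, -⟩) <;> rw [h]
    exact hlt.le
  have uA := mul_le_mul_of_nonneg_left (ua (ea hFA)) hα.le
  have uB := mul_le_mul_of_nonneg_left (ua (eb hFB)) hβ.le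
  have uO := mul_le_mul_of_nonneg_left (ua (eo hFO)) ho.le
  -- First coordinates are at most α and average to α, so none is smaller; this excludes the swapped
  -- maximiser.
  have tA : α ≤ γ / α := le_of_mul_le_mul_left (by linarith) hα
  have tB : α ≤ matchRatio α β γ ε * (β - δ) / β := le_of_mul_le_mul_left (by linarith) hβ
  have ge : ∀ {a b : ℝ}, α ≤ a → (a = α ∧ b = β ∨ a = β ∧ b = α) → a = α ∧ b = β := by
    rintro a b h (h' | ⟨h', -⟩)
    · exact h'
    · exact absurd h (by rw [h']; exact not_le.mpr hlt)
  exact eq_product_of_rows hα hβ (ge tA (ea hFA)).1 (ge tA (ea hFA)).2 (ge tB (eb hFB)).2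

theorem continuous_Phi2 (Δ : ℕ) (lam : ℝ) :
    Continuous fun z : (ℝ × ℝ) × ℝ × ℝ × ℝ =>
      Phi2 Δ lam z.1.1 z.1.2 z.2.1 z.2.2.1 z.2.2.2 := by
  have h := Real.continuous_negMulLog
  simp only [Phi2, entropyH_eq, entropyH1_eq]
  fun_prop

/-- Closedness is joint with the parameters, so that limits along varying (α,β) stay in the limiting
region. -/
theorem isClosed_overlapRegion :
    IsClosed {z : (ℝ × ℝ) × ℝ × ℝ × ℝ | z.2 ∈ overlapRegion z.1.1 z.1.2} := by
  simp only [overlapRegion, Set.ofPred_and]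
  repeat' apply IsClosed.inter
  all_goals exact isClosed_le continuous_const (by fun_prop)

theorem overlapRegion_subset {α β : ℝ} (hα : α ≤ 1) (hβ : β ≤ 1) :
    overlapRegion α β ⊆ Set.Icc (0, 0, 0) (1, 1, 1) := by
  rintro ⟨γ, δ, ε⟩ ⟨h1, h2, h3, h4, h5, -⟩
  exact ⟨⟨h1, h2, h3⟩, ⟨by linarith, by linarith, by linarith⟩⟩

/-- If the rows stay where the first moment exponent is below its tangent planes, then the product
point is the only maximiser. -/
theorem eq_product_of_rows_near {lam α β γ δ ε η p m : ℝ} (hα : 0 < α) (hβ : 0 < β)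
    (ho : 0 < 1 - α - β) (hx : (γ, δ, ε) ∈ overlapRegion α β)
    (hle : 2 * firstMomentExponent lam α β ≤ Phi2 3 lam α β γ δ ε)
    (htan : ∃ La Lb : ℝ, ∀ a' b' : ℝ, |a' - p| < η → |b' - m| < η → ¬ (a' = α ∧ b' = β) →
      firstMomentExponent lam a' b' <
        firstMomentExponent lam α β + La * (a' - α) + Lb * (b' - β))
    (nA : |γ / α - p| < η ∧ |(α - γ - ε) / α - m| < η)
    (nB : |matchRatio α β γ ε * (β - δ) / β - p| < η ∧ |δ / β - m| < η)
    (nO : |matchRatio α β γ ε * (1 - 2 * β + δ - γ - ε) / (1 - α - β) - p| < η ∧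
      |(β - δ + ε + γ - α) / (1 - α - β) - m| < η) :
    (γ, δ, ε) = (α ^ 2, β ^ 2, α * (1 - α - β)) := by
  obtain ⟨La, Lb, H⟩ := htan
  have H' : ∀ a' b' : ℝ, |a' - p| < η ∧ |b' - m| < η → firstMomentExponent lam a' b' ≤
      firstMomentExponent lam α β + La * (a' - α) + Lb * (b' - β) := by
    intro a' b' h
    by_cases he : a' = α ∧ b' = β
    · rw [he.1, he.2]; simp
    · exact (H a' b' h.1 h.2 he).le
  have hT := Phi2_le lam hα hβ ho hx
  obtain ⟨s1, s2⟩ := matchRatio_rows_sum hα hβ ho hx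
  have la := mul_le_mul_of_nonneg_left (H' _ _ nA) hα.le
  have lb := mul_le_mul_of_nonneg_left (H' _ _ nB) hβ.le
  have lo := mul_le_mul_of_nonneg_left (H' _ _ nO) ho.le
  have sa := H _ _ nA.1 nA.2
  have sb := H _ _ nB.1 nB.2
  -- The averaged linear part of the tangent plane vanishes.
  have hsum := congrArg₂ (fun x y => La * x + Lb * y) s1 s2
  beta_reduce at hsum
  generalize firstMomentExponent lam (γ / α) ((α - γ - ε) / α) = FA at *
  generalize firstMomentExponent lam (matchRatio α β γ ε * (β - δ) / β) (δ / β) = FB at *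
  generalize firstMomentExponent lam (matchRatio α β γ ε * (1 - 2 * β + δ - γ - ε) / (1 - α - β))
    ((β - δ + ε + γ - α) / (1 - α - β)) = FO at *
  have rA : γ / α = α ∧ (α - γ - ε) / α = β := by
    by_contra hne
    have := mul_lt_mul_of_pos_left (sa hne) hα
    linarith
  have rB : matchRatio α β γ ε * (β - δ) / β = α ∧ δ / β = β := by
    by_contra hne
    have := mul_lt_mul_of_pos_left (sb hne) hβ
    linarith
  exact eq_product_of_rows hα hβ rA.1 rA.2 rB.2

/-- The rows depend continuously on the parameters near a product point. -/
theorem eventually_rows_near {p m η : ℝ} (hp : 0 < p) (hm : 0 < m) (ho : 0 < 1 - p - m)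
    (hη : 0 < η) :
    ∀ᶠ z : (ℝ × ℝ) × ℝ × ℝ × ℝ in 𝓝 ((p, m), (p ^ 2, m ^ 2, p * (1 - p - m))),
      (|z.2.1 / z.1.1 - p| < η ∧ |(z.1.1 - z.2.1 - z.2.2.2) / z.1.1 - m| < η) ∧
      (|matchRatio z.1.1 z.1.2 z.2.1 z.2.2.2 * (z.1.2 - z.2.2.1) / z.1.2 - p| < η ∧
        |z.2.2.1 / z.1.2 - m| < η) ∧
      (|matchRatio z.1.1 z.1.2 z.2.1 z.2.2.2 * (1 - 2 * z.1.2 + z.2.2.1 - z.2.1 - z.2.2.2)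
          / (1 - z.1.1 - z.1.2) - p| < η ∧
        |(z.1.2 - z.2.2.1 + z.2.2.2 + z.2.1 - z.1.1) / (1 - z.1.1 - z.1.2) - m| < η) := by
  have hW : 1 - m - p ^ 2 - p * (1 - p - m) ≠ 0 := by
    have : 0 < (1 - m) * (1 - p) := mul_pos (by linarith) (by linarith)
    nlinarith
  have hm1 : 1 - m ≠ 0 := by linarith
  have hp1 : 1 - p ≠ 0 := by linarith
  have key : ∀ {f : (ℝ × ℝ) × ℝ × ℝ × ℝ → ℝ} {c : ℝ},
      ContinuousAt f ((p, m), (p ^ 2, m ^ 2, p * (1 - p - m))) →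
      f ((p, m), (p ^ 2, m ^ 2, p * (1 - p - m))) = c →
      ∀ᶠ z in 𝓝 ((p, m), (p ^ 2, m ^ 2, p * (1 - p - m))), |f z - c| < η := by
    intro f c hf hc
    have := Metric.tendsto_nhds.mp hf η hη
    rw [hc] at this
    exact this
  have ht : matchRatio p m (p ^ 2) (p * (1 - p - m)) = p / (1 - m) := by
    rw [matchRatio, div_eq_div_iff hW hm1]; ring
  have htc : ContinuousAt (fun z : (ℝ × ℝ) × ℝ × ℝ × ℝ => matchRatio z.1.1 z.1.2 z.2.1 z.2.2.2)
      ((p, m), (p ^ 2, m ^ 2, p * (1 - p - m))) := by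
    unfold matchRatio
    exact ContinuousAt.div (by fun_prop) (by fun_prop) hW
  refine ((key ?_ ?_).and (key ?_ ?_)).and (((key ?_ ?_).and (key ?_ ?_)).and
    ((key ?_ ?_).and (key ?_ ?_)))
  · exact ContinuousAt.div (by fun_prop) (by fun_prop) hp.ne'
  · field_simp
  · exact ContinuousAt.div (by fun_prop) (by fun_prop) hp.ne'
  · simp only; field_simp; ring
  · exact ContinuousAt.div (by fun_prop) (by fun_prop) hm.ne'
  · simp only [ht]; field_simp
  · exact ContinuousAt.div (by fun_prop) (by fun_prop) hm.ne'
  · field_simp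
  · exact ContinuousAt.div (by fun_prop) (by fun_prop) ho.ne'
  · simp only [ht]; rw [div_eq_iff ho.ne']; field_simp; ring
  · exact ContinuousAt.div (by fun_prop) (by fun_prop) ho.ne'
  · simp only; rw [div_eq_iff ho.ne']; ring

theorem lemma7 (lam pPlus pMinus : ℝ) (hlam : criticalActivity 3 < lam)
    (hplus : IsPPlus 3 lam pPlus) (hminus : IsPMinus 3 lam pMinus)
    (hhalf : 1 / 2 ≤ pPlus) (hone : pPlus < 1) :
    ∃ χ : ℝ, 0 < χ ∧ ∀ α β : ℝ, |pPlus - α| < χ → |pMinus - β| < χ →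
      IsUniqueMaxOn (fun x : ℝ × ℝ × ℝ => Phi2 3 lam α β x.1 x.2.1 x.2.2)
        (overlapRegion α β) (α ^ 2, β ^ 2, α * (1 - α - β)) := by
  have h4 : 4 < lam := by
    have : criticalActivity 3 = 4 := by norm_num [criticalActivity]
    linarith
  obtain ⟨q, r, hq, hr, hqr, hrq, hl, hp, hm⟩ := exists_limits_eq h4 hplus hminus hhalf hone
  have hD : 0 < 1 - q * r := by nlinarith
  have hp0 : 0 < pPlus := by linarith
  have hm0 : 0 < pMinus := by rw [hm]; positivity
  have ho0 : 0 < 1 - pPlus - pMinus := by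
    have : 1 - pPlus - pMinus = q * r / (1 - q * r) := by
      rw [hp, hm, eq_div_iff hD.ne']
      simp only [sub_mul, div_mul_cancel₀ _ hD.ne']
      obtain rfl : r = 1 - q := by linarith
      ring
    rw [this]; positivity
  have hess := hessian_negDef hq hr hqr hrq.ne'
  simp only [← hp, ← hm] at hess
  obtain ⟨η, hη, htan⟩ :=
    exists_forall_firstMomentExponent_lt lam hp0 hm0 ho0 hess.1 hess.2
  have hpos : ∀ᶠ c : ℝ × ℝ in 𝓝 (pPlus, pMinus), 0 < c.1 ∧ 0 < c.2 ∧ 0 < 1 - c.1 - c.2 ∧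
      |c.1 - pPlus| < η ∧ |c.2 - pMinus| < η := by
    refine ((?_ : ∀ᶠ _ in _, _).and (Eventually.and ?_ (Eventually.and ?_
      (Eventually.and ?_ ?_))))
    · exact continuousAt_const.eventually_lt (by fun_prop) hp0
    · exact continuousAt_const.eventually_lt (by fun_prop) hm0
    · exact continuousAt_const.eventually_lt (by fun_prop) ho0
    · exact ContinuousAt.eventually_lt (by fun_prop) continuousAt_const (by simpa using hη)
    · exact ContinuousAt.eventually_lt (by fun_prop) continuousAt_const (by simpa using hη)
  suffices h : ∀ᶠ c : ℝ × ℝ in 𝓝 (pPlus, pMinus), ∀ x ∈ overlapRegion c.1 c.2,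
      Phi2 3 lam c.1 c.2 (c.1 ^ 2) (c.2 ^ 2) (c.1 * (1 - c.1 - c.2)) ≤
        Phi2 3 lam c.1 c.2 x.1 x.2.1 x.2.2 → x = (c.1 ^ 2, c.2 ^ 2, c.1 * (1 - c.1 - c.2)) by
    obtain ⟨χ, hχ, H⟩ := Metric.eventually_nhds_iff.mp (hpos.and h)
    refine ⟨χ, hχ, fun α β hα hβ => ?_⟩
    obtain ⟨⟨a0, b0, o0, -⟩, H⟩ := H (y := (α, β)) (by
      rw [dist_comm, Prod.dist_eq, Real.dist_eq, Real.dist_eq]; exact max_lt hα hβ)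
    exact ⟨product_mem_overlapRegion a0 b0 o0,
      fun x hx hne => lt_of_not_ge fun hle => hne (H x hx hle)⟩
  -- Otherwise some parameters tending to (p⁺,p⁻) have competitors other than the product point; a
  -- convergent subsequence of these is extracted.
  by_contra hcon
  obtain ⟨c, hc, hbad⟩ := Filter.exists_seq_forall_of_frequently (not_eventually.mp hcon)
  push Not at hbad
  choose x hx hle hne using hbad
  -- Shifting by `N` keeps all parameters in the good neighbourhood, so the competitors lie in a
  -- fixed cube.
  obtain ⟨N, hN⟩ := eventually_atTop.mp (hc.eventually hpos)
  have hcomp : ∀ n, x (n + N) ∈ Set.Icc ((0, 0, 0) : ℝ × ℝ × ℝ) (1, 1, 1) := fun n => by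
    obtain ⟨k1, k2, k3, -⟩ := hN (n + N) (Nat.le_add_left _ _)
    exact overlapRegion_subset (by linarith) (by linarith) (hx (n + N))
  obtain ⟨x₀, -, φ, hφ, hlim⟩ := isCompact_Icc.tendsto_subseq hcomp
  have hsub : Tendsto (fun n => φ n + N) atTop atTop :=
    (tendsto_add_atTop_nat N).comp hφ.tendsto_atTop
  have hlim2 : Tendsto (fun n => (c (φ n + N), x (φ n + N))) atTop
      (𝓝 ((pPlus, pMinus), x₀)) := (hc.comp hsub).prodMk_nhds hlim
  have hx₀ : x₀ ∈ overlapRegion pPlus pMinus :=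
    isClosed_overlapRegion.mem_of_tendsto hlim2 (Eventually.of_forall fun n => hx (φ n + N))
  have hPhi := ((continuous_Phi2 3 lam).tendsto _).comp hlim2
  have hprod : Tendsto (fun n => ((c (φ n + N)),
      ((c (φ n + N)).1 ^ 2, (c (φ n + N)).2 ^ 2,
        (c (φ n + N)).1 * (1 - (c (φ n + N)).1 - (c (φ n + N)).2)))) atTop
      (𝓝 ((pPlus, pMinus), (pPlus ^ 2, pMinus ^ 2, pPlus * (1 - pPlus - pMinus)))) := by
    have : Continuous fun c : ℝ × ℝ => (c, (c.1 ^ 2, c.2 ^ 2, c.1 * (1 - c.1 - c.2))) := by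
      fun_prop
    exact (this.tendsto (pPlus, pMinus)).comp (hc.comp hsub)
  have hPhi' := ((continuous_Phi2 3 lam).tendsto _).comp hprod
  have hle₀ := le_of_tendsto_of_tendsto' hPhi' hPhi fun n => hle (φ n + N)
  simp only at hle₀
  rw [Phi2_product lam hp0 ho0] at hle₀
  have hx₀eq : x₀ = (pPlus ^ 2, pMinus ^ 2, pPlus * (1 - pPlus - pMinus)) := by
    obtain ⟨γ, δ, ε⟩ := x₀
    rw [hp, hm] at hx₀ hle₀ ho0 ⊢
    rw [hl] at hle₀
    exact eq_product_of_Phi2_le hr hqr hrq hx₀ hle₀ ho0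
  -- The competitors converge to the product point, so their rows enter the region of strict
  -- concavity, where no competitor exists.
  rw [hx₀eq] at hlim2
  obtain ⟨n, hn⟩ := (hlim2.eventually (eventually_rows_near hp0 hm0 ho0 hη)).exists
  obtain ⟨a0, b0, o0, na, nb⟩ := hN (φ n + N) (Nat.le_add_left _ _)
  have hle' := hle (φ n + N)
  rw [Phi2_product lam a0 o0] at hle'
  exact hne (φ n + N) (eq_product_of_rows_near a0 b0 o0 (hx (φ n + N)) hle' (htan _ _ na nb)
    hn.1 hn.2.1 hn.2.2)
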